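/- Let $0<q<1$. Let $\mathcal{O}(\mathrm{SU}_q(2))$ be the complex Hopf algebra with generators $a,b,c,d$, relations $$ab=q\,ba,\ \ ac=q\,ca,\ \ bd=q\,db,\ \ cd=q\,dc,\ \ bc=cb,\ \ ad-q\,bc=1,\ \ da-q^{-1}bc=1,$$ comultiplication $\Delta(u_{ij})=\sum_k u_{ik}\otimes u_{kj}$ and counit $\varepsilon(u_{ij})=\delta_{ij}$, where $u=\begin{pmatrix}a&b\\c&d\end{pmatrix}$. Let $\mathcal{U}_q(\mathrm{su}_2)$ be the Hopf algebra with generators $E,F,K,K^{-1}$, relations $$KK^{-1}=K^{-1}K=1,\quad KE=qEK,\quad FK=qKF,\quad EF-FE=(q-q^{-1})^{-1}(K^2-K^{-2}),$$ comultiplication $\Delta(E)=E\otimes K+K^{-1}\otimes E$, $\Delta(F)=F\otimes K+K^{-1}\otimes F$, $\Delta(K)=K\otimes K$, and antipode $S(K)=K^{-1}$, $S(E)=-qE$, $S(F)=-q^{-1}F$. Let $\langle\cdot,\cdot\rangle$ be the dual pairing of $\mathcal{U}_q(\mathrm{su}_2)$ and $\mathcal{O}(\mathrm{SU}_q(2))$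 whose values on generators are $\langle K^{\pm1},d\rangle=\langle K^{\mp1},a\rangle=q^{\pm1/2}$, $\langle E,c\rangle=\langle F,b\rangle=1$, and zero otherwise. In Sweedler notation put $$f\triangleright x=\langle f,x_{(2)}\rangle x_{(1)},\qquad x\triangleleft f=\langle f,x_{(1)}\rangle x_{(2)},\qquad R_f(x)=x\triangleleft S^{-1}(f).$$ Let $\mathcal{O}(\mathrm{S}_q^2)$ be the unital subalgebra of $\mathcal{O}(\mathrm{SU}_q(2))$ generated by $A=-q^{-1}bc$, $B=ac$ and $B^*=-db$ (the standard Podleś sphere), and let $\sigma$ be the algebra automorphism $\sigma(x)=K^{-2}\triangleright x$ of $\mathcal{O}(\mathrm{S}_q^2)$. For an algebra $\mathcal{X}$ with automorphism $\sigma$ and an $(n+1)$-linear form $\varphi$ on $\mathcal{X}$ put $$(b_\sigma\varphi)(x_0,\dots,x_{n+1})=\sum_{j=0}^{n}(-1)^j\varphi(x_0,\dots,x_jx_{j+1},\dots,x_{n+1})+(-1)^{n+1}\varphi(\sigma(x_{n+1})x_0,x_1,\dots,x_n),$$ $$(\lambda_\sigma\varphi)(x_0,\dots,x_n)=(-1)^n\varphi(\sigma(x_n),x_0,\dots,x_{n-1}).$$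 The form $\varphi$ is a $\sigma$-twisted cyclic $n$-cocycle if $b_\sigma\varphi=0$ and $\lambda_\sigma\varphi=\varphi$. It is non-trivial if there is no $n$-linear form $\psi$ with $\varphi=b_\sigma\psi$ and $\lambda_\sigma\psi=\psi$. Then $\mathcal{O}(\mathrm{SU}_q(2))$ has a unique Haar state $h$, that is, a unique linear functional $h$ with $h(1)=1$ and $h(x_{(2)})x_{(1)}=h(x)1=h(x_{(1)})x_{(2)}$ for all $x$, and $$\tau(x_0,x_1,x_2)=h\bigl(x_0(R_F(x_1)R_E(x_2)-q^2R_E(x_1)R_F(x_2))\bigr),\qquad x_0,x_1,x_2\in\mathcal{O}(\mathrm{S}_q^2),$$ is a non-trivial $\sigma$-twisted cyclic $2$-cocycle on $\mathcal{O}(\mathrm{S}_q^2)$. -/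

import Mathlib

open scoped TensorProduct

namespace QSphere

/-- The deformation parameter: a real number `q` with `0 < q < 1`. -/
abbrev Param : Type := Set.Ioo (0 : ℝ) 1

namespace Param

/-- `q` as a complex number. -/
def toC (q : Param) : ℂ := ((q : ℝ) : ℂ)

/-- `q ^ (1 / 2)` as a complex number. -/
noncomputable def root (q : Param) : ℂ := ((Real.sqrt (q : ℝ) : ℝ) : ℂ)

theorem toC_ne_zero (q : Param) : q.toC ≠ 0 := Complex.ofReal_ne_zero.mpr q.2.1.ne'

theorem root_mul_root (q : Param) : q.root * q.root = q.toC := by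
  rw [root, toC, ← Complex.ofReal_mul, Real.mul_self_sqrt q.2.1.le]

theorem root_ne_zero (q : Param) : q.root ≠ 0 :=
  Complex.ofReal_ne_zero.mpr (Real.sqrt_pos.mpr q.2.1).ne'

theorem sub_inv_ne_zero (q : Param) : q.toC - q.toC⁻¹ ≠ 0 := by
  have h : (q : ℝ) - (q : ℝ)⁻¹ ≠ 0 := by
    have h1 : (1 : ℝ) < (q : ℝ)⁻¹ := (one_lt_inv₀ q.2.1).mpr q.2.2
    have h2 := q.2.2
    linarith
  rw [toC, ← Complex.ofReal_inv, ← Complex.ofReal_sub]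
  exact Complex.ofReal_ne_zero.mpr h

end Param

/-- The generators `a, b, c, d` of the coordinate algebra of quantum `SU(2)`. -/
inductive SUGen : Type
  | a | b | c | d

open FreeAlgebra in
/-- The defining relations of the coordinate algebra of quantum `SU(2)`:
`ab = q ba`, `ac = q ca`, `bd = q db`, `cd = q dc`, `bc = cb`, `ad - q bc = 1`, `da - q⁻¹ bc = 1`. -/
inductive SURel (q : Param) : FreeAlgebra ℂ SUGen → FreeAlgebra ℂ SUGen → Prop
  | ab : SURel q (ι ℂ .a * ι ℂ .b) (q.toC • (ι ℂ .b * ι ℂ .a))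
  | ac : SURel q (ι ℂ .a * ι ℂ .c) (q.toC • (ι ℂ .c * ι ℂ .a))
  | bd : SURel q (ι ℂ .b * ι ℂ .d) (q.toC • (ι ℂ .d * ι ℂ .b))
  | cd : SURel q (ι ℂ .c * ι ℂ .d) (q.toC • (ι ℂ .d * ι ℂ .c))
  | bc : SURel q (ι ℂ .b * ι ℂ .c) (ι ℂ .c * ι ℂ .b)
  | ad : SURel q (ι ℂ .a * ι ℂ .d - q.toC • (ι ℂ .b * ι ℂ .c)) 1
  | da : SURel q (ι ℂ .d * ι ℂ .a - q.toC⁻¹ • (ι ℂ .b * ι ℂ .c)) 1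

/-- The coordinate algebra `O(SU_q(2))`. -/
def OSU (q : Param) : Type := RingQuot (SURel q)

namespace OSU

variable {q : Param}

noncomputable instance : Ring (OSU q) := inferInstanceAs (Ring (RingQuot (SURel q)))

noncomputable instance : Algebra ℂ (OSU q) := inferInstanceAs (Algebra ℂ (RingQuot (SURel q)))

/-- The generators as elements of `O(SU_q(2))`. -/
noncomputable def gen (q : Param) (g : SUGen) : OSU q :=
  RingQuot.mkAlgHom ℂ (SURel q) (FreeAlgebra.ι ℂ g)

theorem gen_rel {s t : FreeAlgebra ℂ SUGen} (h : SURel q s t) :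
    FreeAlgebra.lift ℂ (gen q) s = FreeAlgebra.lift ℂ (gen q) t := by
  have key : FreeAlgebra.lift ℂ (gen q) = RingQuot.mkAlgHom ℂ (SURel q) := by
    ext g; simp [gen]; rfl
  rw [key]
  exact RingQuot.mkAlgHom_rel ℂ h

theorem ba : gen q .b * gen q .a = q.toC⁻¹ • (gen q .a * gen q .b) := by
  have h : gen q .a * gen q .b = q.toC • (gen q .b * gen q .a) := by simpa using gen_rel (q := q) .ab
  rw [h, inv_smul_smul₀ q.toC_ne_zero]

theorem ca : gen q .c * gen q .a = q.toC⁻¹ • (gen q .a * gen q .c) := by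
  have h : gen q .a * gen q .c = q.toC • (gen q .c * gen q .a) := by simpa using gen_rel (q := q) .ac
  rw [h, inv_smul_smul₀ q.toC_ne_zero]

theorem db : gen q .d * gen q .b = q.toC⁻¹ • (gen q .b * gen q .d) := by
  have h : gen q .b * gen q .d = q.toC • (gen q .d * gen q .b) := by simpa using gen_rel (q := q) .bd
  rw [h, inv_smul_smul₀ q.toC_ne_zero]

theorem dc : gen q .d * gen q .c = q.toC⁻¹ • (gen q .c * gen q .d) := by
  have h : gen q .c * gen q .d = q.toC • (gen q .d * gen q .c) := by simpa using gen_rel (q := q) .cd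
  rw [h, inv_smul_smul₀ q.toC_ne_zero]

theorem cb : gen q .c * gen q .b = gen q .b * gen q .c := by
  simpa using (gen_rel (q := q) .bc).symm

theorem ad : gen q .a * gen q .d = 1 + q.toC • (gen q .b * gen q .c) := by
  rw [← sub_eq_iff_eq_add]; simpa using gen_rel (q := q) .ad

theorem da : gen q .d * gen q .a = 1 + q.toC⁻¹ • (gen q .b * gen q .c) := by
  rw [← sub_eq_iff_eq_add]; simpa using gen_rel (q := q) .da

/-- The universal property of `O(SU_q(2))`. -/
noncomputable def lift {X : Type*} [Ring X] [Algebra ℂ X] (f : SUGen → X)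
    (hf : ∀ ⦃s t : FreeAlgebra ℂ SUGen⦄, SURel q s t →
      FreeAlgebra.lift ℂ f s = FreeAlgebra.lift ℂ f t) : OSU q →ₐ[ℂ] X :=
  RingQuot.liftAlgHom ℂ ⟨FreeAlgebra.lift ℂ f, hf⟩

@[simp]
theorem lift_gen {X : Type*} [Ring X] [Algebra ℂ X] (f : SUGen → X)
    (hf : ∀ ⦃s t : FreeAlgebra ℂ SUGen⦄, SURel q s t →
      FreeAlgebra.lift ℂ f s = FreeAlgebra.lift ℂ f t) (g : SUGen) :
    lift (q := q) f hf (gen q g) = f g := by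
  exact (RingQuot.liftAlgHom_mkAlgHom_apply ℂ (FreeAlgebra.lift ℂ f) hf (FreeAlgebra.ι ℂ g)).trans
    (FreeAlgebra.lift_ι_apply f g)

theorem hom_ext {X : Type*} [Semiring X] [Algebra ℂ X] {φ ψ : OSU q →ₐ[ℂ] X}
    (h : ∀ g, φ (gen q g) = ψ (gen q g)) : φ = ψ := by
  refine RingQuot.ringQuot_ext' ℂ φ ψ (FreeAlgebra.hom_ext (funext fun g => h g))

/-- The comultiplication on generators: `Δ(u_ij) = ∑ₖ u_ik ⊗ u_kj` for the fundamental matrix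
`u = (a b; c d)`. -/
noncomputable def comulGen (q : Param) : SUGen → OSU q ⊗[ℂ] OSU q
  | .a => gen q .a ⊗ₜ gen q .a + gen q .b ⊗ₜ gen q .c
  | .b => gen q .a ⊗ₜ gen q .b + gen q .b ⊗ₜ gen q .d
  | .c => gen q .c ⊗ₜ gen q .a + gen q .d ⊗ₜ gen q .c
  | .d => gen q .c ⊗ₜ gen q .b + gen q .d ⊗ₜ gen q .d

/-- The counit on generators. -/
def counitGen : SUGen → ℂ
  | .a => 1
  | .b => 0
  | .c => 0
  | .d => 1

theorem comulGen_rel (q : Param) ⦃s t : FreeAlgebra ℂ SUGen⦄ (h : SURel q s t) :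
    FreeAlgebra.lift ℂ (comulGen q) s = FreeAlgebra.lift ℂ (comulGen q) t := by
  have hq := q.toC_ne_zero
  cases h <;>
  simp only [map_mul, map_smul, map_sub, map_one, FreeAlgebra.lift_ι_apply, comulGen, mul_add,
    add_mul, Algebra.TensorProduct.tmul_mul_tmul, ba, ca, db, dc, cb, ad, da,
    TensorProduct.add_tmul, TensorProduct.tmul_add, TensorProduct.tmul_smul,
    ← TensorProduct.smul_tmul', smul_add, smul_smul, Algebra.TensorProduct.one_def] <;>
  match_scalars <;> field_simp <;> ring

/-- The comultiplication of `O(SU_q(2))`. -/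
noncomputable def comulHom (q : Param) : OSU q →ₐ[ℂ] OSU q ⊗[ℂ] OSU q :=
  lift (comulGen q) (comulGen_rel q)

/-- The counit of `O(SU_q(2))`. -/
noncomputable def counitHom (q : Param) : OSU q →ₐ[ℂ] ℂ :=
  lift counitGen (by
    intro s t h
    cases h <;> simp [counitGen])

noncomputable instance : Bialgebra ℂ (OSU q) :=
  Bialgebra.ofAlgHom (comulHom q) (counitHom q)
    (hom_ext (by
      rintro (_ | _ | _ | _) <;>
      simp [comulHom, comulGen, TensorProduct.add_tmul, TensorProduct.tmul_add] <;> abel))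
    (hom_ext (by
      rintro (_ | _ | _ | _) <;> simp [comulHom, counitHom, comulGen, counitGen]))
    (hom_ext (by
      rintro (_ | _ | _ | _) <;> simp [comulHom, counitHom, comulGen, counitGen]))


@[simp]
theorem comul_gen (g : SUGen) : Coalgebra.comul (R := ℂ) (gen q g) = comulGen q g :=
  lift_gen _ _ g

@[simp]
theorem counit_gen (g : SUGen) : Coalgebra.counit (R := ℂ) (gen q g) = counitGen g :=
  lift_gen _ _ g

theorem induction {P : OSU q → Prop} (halg : ∀ r : ℂ, P (algebraMap ℂ (OSU q) r))
    (hgen : ∀ g, P (gen q g)) (hmul : ∀ x y, P x → P y → P (x * y))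
    (hadd : ∀ x y, P x → P y → P (x + y)) (x : OSU q) : P x := by
  obtain ⟨y, rfl⟩ := RingQuot.mkAlgHom_surjective ℂ (SURel q) x
  induction y using FreeAlgebra.induction with
  | grade0 r =>
    have h : RingQuot.mkAlgHom ℂ (SURel q) (algebraMap ℂ _ r) = algebraMap ℂ (OSU q) r :=
      AlgHom.commutes (RingQuot.mkAlgHom ℂ (SURel q)) r
    rw [h]; exact halg r
  | grade1 g => exact hgen g
  | mul a b ha hb => rw [map_mul]; exact hmul _ _ ha hb
  | add a b ha hb => rw [map_add]; exact hadd _ _ ha hb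

theorem eq_zero_of_skew {D : OSU q →ₗ[ℂ] ℂ} (f g : OSU q → ℂ) (h1 : D 1 = 0)
    (hgen : ∀ s, D (gen q s) = 0) (hmul : ∀ x y, D (x * y) = D x * f y + g x * D y) : D = 0 := by
  ext x
  induction x using induction with
  | halg r => rw [Algebra.algebraMap_eq_smul_one, map_smul, h1]; simp
  | hgen s => exact hgen s
  | hmul x y hx hy => rw [hmul, hx, hy]; simp
  | hadd x y hx hy => rw [map_add, hx, hy]; simp

end OSU

/-- The dual algebra of the coalgebra `O(SU_q(2))`: linear functionals with the convolution
product `(f * g)(x) = f(x₍₁₎) g(x₍₂₎)`. -/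
abbrev Fun (q : Param) : Type := WithConv (OSU q →ₗ[ℂ] ℂ)

namespace Fun

open OSU WithConv

variable {q : Param}

theorem conv_mul_apply (f f₁ f₁' f₂ f₂' g g₁ g₁' g₂ g₂' : Fun q)
    (hf : ∀ x y, f (x * y) = f₁ x * f₁' y + f₂ x * f₂' y)
    (hg : ∀ x y, g (x * y) = g₁ x * g₁' y + g₂ x * g₂' y) (x y : OSU q) :
    (f * g) (x * y) = (f₁ * g₁) x * (f₁' * g₁') y + (f₁ * g₂) x * (f₁' * g₂') y +
      (f₂ * g₁) x * (f₂' * g₁') y + (f₂ * g₂) x * (f₂' * g₂') y := by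
  simp only [LinearMap.convMul_apply, Bialgebra.comul_mul]
  generalize Coalgebra.comul (R := ℂ) x = X
  generalize Coalgebra.comul (R := ℂ) y = Y
  induction X with
  | zero => simp
  | add X₁ X₂ h₁ h₂ => simp only [add_mul, map_add, h₁, h₂]; ring
  | tmul x₁ x₂ =>
    induction Y with
    | zero => simp
    | add Y₁ Y₂ h₁ h₂ => simp only [mul_add, map_add, h₁, h₂]; ring
    | tmul y₁ y₂ =>
      simp only [Algebra.TensorProduct.tmul_mul_tmul, TensorProduct.map_tmul,
        LinearMap.mul'_apply]
      erw [hf, hg]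
      ring


/-- Values on generators of the character `torus`. -/
noncomputable def torusGen (t : ℂ) : SUGen → ℂ
  | .a => t⁻¹
  | .b => 0
  | .c => 0
  | .d => t

/-- The character of `O(SU_q(2))` with `a ↦ t⁻¹`, `d ↦ t`, `b, c ↦ 0`. -/
noncomputable def torus (q : Param) (t : ℂ) (ht : t ≠ 0) : OSU q →ₐ[ℂ] ℂ :=
  lift (torusGen t) (by
    intro s u h
    cases h <;> simp [torusGen, ht])

/-- Values on generators of the representation `skewRep`. -/
noncomputable def skewGen (q : Param) (β γ : ℂ) : SUGen → Matrix (Fin 2) (Fin 2) ℂ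
  | .a => !![q.root, 0; 0, q.root⁻¹]
  | .b => !![0, β; 0, 0]
  | .c => !![0, γ; 0, 0]
  | .d => !![q.root⁻¹, 0; 0, q.root]

/-- A representation of `O(SU_q(2))` by upper triangular matrices. Its diagonal entries are the
characters `⟨K⁻¹, ·⟩` and `⟨K, ·⟩`, so that its upper right entry is a functional `φ` with
`φ(xy) = φ(x) ⟨K, y⟩ + ⟨K⁻¹, x⟩ φ(y)`; see `skewRep_apply` and `skew_mul`. -/
noncomputable def skewRep (q : Param) (β γ : ℂ) : OSU q →ₐ[ℂ] Matrix (Fin 2) (Fin 2) ℂ :=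
  lift (skewGen q β γ) (by
    have h0 := q.root_ne_zero
    intro s u h
    cases h <;> ext i j <;> fin_cases i <;> fin_cases j <;>
      simp [skewGen, ← q.root_mul_root, h0] <;> field_simp)

/-- The functional `⟨K, ·⟩`: the character with `⟨K, d⟩ = q^(1/2)`, `⟨K, a⟩ = q^(-1/2)`. -/
noncomputable def K (q : Param) : Fun q :=
  toConv (torus q q.root q.root_ne_zero).toLinearMap

/-- The functional `⟨K⁻¹, ·⟩`: the character with `⟨K⁻¹, d⟩ = q^(-1/2)`, `⟨K⁻¹, a⟩ = q^(1/2)`. -/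
noncomputable def Kinv (q : Param) : Fun q :=
  toConv (torus q q.root⁻¹ (inv_ne_zero q.root_ne_zero)).toLinearMap

/-- The functional `φ` with `φ(xy) = φ(x) ⟨K, y⟩ + ⟨K⁻¹, x⟩ φ(y)`, `φ(b) = β`, `φ(c) = γ`,
`φ(a) = φ(d) = 0`. -/
noncomputable def skew (q : Param) (β γ : ℂ) : Fun q :=
  toConv (Matrix.entryLinearMap ℂ ℂ (0 : Fin 2) (1 : Fin 2) ∘ₗ (skewRep q β γ).toLinearMap)

/-- The functional `⟨E, ·⟩`; on generators it is `1` at `c` and zero otherwise. -/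
noncomputable def E (q : Param) : Fun q := skew q 0 1

/-- The functional `⟨F, ·⟩`; on generators it is `1` at `b` and zero otherwise. -/
noncomputable def F (q : Param) : Fun q := skew q 1 0

theorem torus_gen (t : ℂ) (ht : t ≠ 0) (g : SUGen) : torus q t ht (gen q g) = torusGen t g :=
  lift_gen _ _ g

theorem K_gen (g : SUGen) : K q (gen q g) = torusGen q.root g := lift_gen _ _ g

theorem Kinv_gen (g : SUGen) : Kinv q (gen q g) = torusGen q.root⁻¹ g := lift_gen _ _ g

theorem skew_gen (β γ : ℂ) (g : SUGen) : skew q β γ (gen q g) = skewGen q β γ g 0 1 :=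
  congrArg (fun M : Matrix (Fin 2) (Fin 2) ℂ => M 0 1) (lift_gen _ _ g)

theorem K_one : K q 1 = 1 := map_one (torus q _ q.root_ne_zero)

theorem Kinv_one : Kinv q 1 = 1 := map_one (torus q _ (inv_ne_zero q.root_ne_zero))

theorem skew_one (β γ : ℂ) : skew q β γ 1 = 0 := by
  change skewRep q β γ 1 0 1 = 0
  simp

theorem K_mul (x y : OSU q) : K q (x * y) = K q x * K q y :=
  map_mul (torus q _ q.root_ne_zero) x y

theorem Kinv_mul (x y : OSU q) : Kinv q (x * y) = Kinv q x * Kinv q y :=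
  map_mul (torus q _ (inv_ne_zero q.root_ne_zero)) x y

theorem skewRep_apply (β γ : ℂ) (x : OSU q) :
    skewRep q β γ x 0 0 = Kinv q x ∧ skewRep q β γ x 1 0 = 0 ∧ skewRep q β γ x 1 1 = K q x := by
  induction x using OSU.induction with
  | halg r =>
    rw [AlgHom.commutes]
    refine ⟨?_, ?_, ?_⟩
    · change _ = torus q _ (inv_ne_zero q.root_ne_zero) _
      rw [AlgHom.commutes]; simp [Matrix.algebraMap_matrix_apply]
    · simp [Matrix.algebraMap_matrix_apply]
    · change _ = torus q _ q.root_ne_zero _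
      rw [AlgHom.commutes]; simp [Matrix.algebraMap_matrix_apply]
  | hgen g =>
    rw [K_gen, Kinv_gen, skewRep, lift_gen]
    cases g <;> simp [skewGen, torusGen]
  | hmul x y hx hy =>
    obtain ⟨h1, h2, h3⟩ := hx
    obtain ⟨k1, k2, k3⟩ := hy
    rw [K_mul, Kinv_mul, map_mul]
    simp [Matrix.mul_apply, Fin.sum_univ_two, h1, h2, h3, k1, k2, k3]
  | hadd x y hx hy =>
    obtain ⟨h1, h2, h3⟩ := hx
    obtain ⟨k1, k2, k3⟩ := hy
    simp [h1, h2, h3, k1, k2, k3]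

/-- Skew-primitivity, dual to `Δ(E) = E ⊗ K + K⁻¹ ⊗ E`, `Δ(F) = F ⊗ K + K⁻¹ ⊗ F`. -/
theorem skew_mul (β γ : ℂ) (x y : OSU q) :
    skew q β γ (x * y) = skew q β γ x * K q y + Kinv q x * skew q β γ y := by
  change skewRep q β γ (x * y) 0 1 = skewRep q β γ x 0 1 * _ + _ * skewRep q β γ y 0 1
  rw [← (skewRep_apply β γ x).1, ← (skewRep_apply β γ y).2.2, map_mul, Matrix.mul_apply,
    Fin.sum_univ_two]
  ring

theorem torus_conv (s t : ℂ) (hs : s ≠ 0) (ht : t ≠ 0) :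
    (toConv (torus q s hs).toLinearMap * toConv (torus q t ht).toLinearMap : Fun q) =
      toConv (torus q (s * t) (mul_ne_zero hs ht)).toLinearMap := by
  rw [← AlgHom.toLinearMap_convMul (toConv (torus q s hs)) (toConv (torus q t ht))]
  congr 2
  refine hom_ext fun g => ?_
  erw [AlgHom.convMul_apply]
  rw [comul_gen, torus_gen]
  cases g <;> simp [comulGen, torus_gen, torusGen, mul_comm]

theorem torus_one : (toConv (torus q 1 one_ne_zero).toLinearMap : Fun q) = 1 := by
  have h : torus q 1 one_ne_zero = counitHom q := by
    refine hom_ext fun g => ?_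
    rw [torus_gen, counitHom, lift_gen]
    cases g <;> simp [torusGen, counitGen]
  rw [h]; rfl

theorem K_mul_Kinv : K q * Kinv q = 1 := by
  rw [K, Kinv, torus_conv, ← torus_one]
  congr 2
  simp [q.root_ne_zero]

theorem Kinv_mul_K : Kinv q * K q = 1 := by
  rw [K, Kinv, torus_conv, ← torus_one]
  congr 2
  simp [q.root_ne_zero]


theorem ext_of_skew {D₁ D₂ : Fun q} (f g : Fun q) (h1 : D₁ 1 = D₂ 1)
    (hgen : ∀ s, D₁ (gen q s) = D₂ (gen q s))
    (hmul₁ : ∀ x y, D₁ (x * y) - D₂ (x * y) = (D₁ x - D₂ x) * f y + g x * (D₁ y - D₂ y)) :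
    D₁ = D₂ := by
  have h : D₁.ofConv - D₂.ofConv = 0 :=
    eq_zero_of_skew (fun x => f x) (fun x => g x) (sub_eq_zero.mpr h1) (fun s => sub_eq_zero.mpr (hgen s)) hmul₁
  exact WithConv.ext (sub_eq_zero.mp h)

theorem mul_one_apply (f g : Fun q) : (f * g) 1 = f 1 * g 1 := by
  simp [LinearMap.convMul_apply, Algebra.TensorProduct.one_def]

theorem smul_app (r : ℂ) (f : Fun q) (x : OSU q) : (r • f) x = r * f x := rfl

theorem sub_app (f g : Fun q) (x : OSU q) : (f - g) x = f x - g x := rfl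

theorem K_mul_skew (β γ : ℂ) (c : ℂ) (h : ∀ s, (K q * skew q β γ) (gen q s) =
    c * (skew q β γ * K q) (gen q s)) : K q * skew q β γ = c • (skew q β γ * K q) := by
  refine ext_of_skew (K q * K q) (1 : Fun q) ?_ (fun s => ?_) (fun x y => ?_)
  · simp only [smul_app, mul_one_apply, skew_one]; ring
  · rw [smul_app, h]
  · have h1 := conv_mul_apply (K q) (K q) (K q) 0 0 (skew q β γ) (skew q β γ) (K q) (Kinv q)
      (skew q β γ) (fun x y => by rw [K_mul]; exact (add_zero _).symm.trans (by congr 1; exact (zero_mul _).symm))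
      (skew_mul β γ) x y
    have h2 := conv_mul_apply (skew q β γ) (skew q β γ) (K q) (Kinv q)
      (skew q β γ) (K q) (K q) (K q) 0 0 (skew_mul β γ)
      (fun x y => by rw [K_mul]; exact (add_zero _).symm.trans (by congr 1; exact (zero_mul _).symm)) x y
    simp only [smul_app]
    rw [h1, h2, K_mul_Kinv, Kinv_mul_K]
    have z : ∀ w, (0 : Fun q) w = 0 := fun w => rfl
    simp only [zero_mul, mul_zero, z]
    ring

theorem gen_conv (f g : Fun q) :
    (f * g) (gen q .a) = f (gen q .a) * g (gen q .a) + f (gen q .b) * g (gen q .c) ∧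
    (f * g) (gen q .b) = f (gen q .a) * g (gen q .b) + f (gen q .b) * g (gen q .d) ∧
    (f * g) (gen q .c) = f (gen q .c) * g (gen q .a) + f (gen q .d) * g (gen q .c) ∧
    (f * g) (gen q .d) = f (gen q .c) * g (gen q .b) + f (gen q .d) * g (gen q .d) := by
  simp [LinearMap.convMul_apply, comulGen]

theorem K_mul_E : K q * E q = q.toC • (E q * K q) := by
  have h0 := q.root_ne_zero
  refine K_mul_skew 0 1 _ fun s => ?_
  obtain ⟨h1, h2, h3, h4⟩ := gen_conv (K q) (skew q 0 1)
  obtain ⟨k1, k2, k3, k4⟩ := gen_conv (skew q 0 1) (K q)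
  cases s
  · rw [h1, k1]; simp [K_gen, skew_gen, skewGen, torusGen]
  · rw [h2, k2]; simp [K_gen, skew_gen, skewGen, torusGen]
  · rw [h3, k3]; simp [K_gen, skew_gen, skewGen, torusGen, ← q.root_mul_root, h0]
  · rw [h4, k4]; simp [K_gen, skew_gen, skewGen, torusGen]

theorem F_mul_K : F q * K q = q.toC • (K q * F q) := by
  have h0 := q.root_ne_zero
  rw [F, K_mul_skew 1 0 q.toC⁻¹ fun s => ?_, smul_inv_smul₀ q.toC_ne_zero]
  obtain ⟨h1, h2, h3, h4⟩ := gen_conv (K q) (skew q 1 0)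
  obtain ⟨k1, k2, k3, k4⟩ := gen_conv (skew q 1 0) (K q)
  cases s
  · rw [h1, k1]; simp [K_gen, skew_gen, skewGen, torusGen]
  · rw [h2, k2]; simp [K_gen, skew_gen, skewGen, torusGen, ← q.root_mul_root, h0]
  · rw [h3, k3]; simp [K_gen, skew_gen, skewGen, torusGen]
  · rw [h4, k4]; simp [K_gen, skew_gen, skewGen, torusGen]

theorem E_mul_Kinv : E q * Kinv q = q.toC • (Kinv q * E q) := by
  calc E q * Kinv q = Kinv q * (K q * E q) * Kinv q := by
        rw [← mul_assoc, Kinv_mul_K, one_mul]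
    _ = q.toC • (Kinv q * E q) := by
        rw [K_mul_E, mul_smul_comm, smul_mul_assoc, mul_assoc, mul_assoc, K_mul_Kinv, mul_one]

theorem Kinv_mul_F : Kinv q * F q = q.toC • (F q * Kinv q) := by
  calc Kinv q * F q = Kinv q * (F q * K q) * Kinv q := by
        rw [mul_assoc, mul_assoc, K_mul_Kinv, mul_one]
    _ = q.toC • (F q * Kinv q) := by
        rw [F_mul_K, mul_smul_comm, smul_mul_assoc, ← mul_assoc, Kinv_mul_K, one_mul]

theorem E_F_comm : E q * F q - F q * E q =
    (q.toC - q.toC⁻¹)⁻¹ • (K q * K q - Kinv q * Kinv q) := by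
  have hq := q.toC_ne_zero
  refine ext_of_skew (K q * K q) (Kinv q * Kinv q) ?_ (fun s => ?_) (fun x y => ?_)
  · simp only [smul_app, sub_app, mul_one_apply, E, F, skew_one, K_one, Kinv_one]; ring
  · have h0 := q.root_ne_zero
    have hl := q.sub_inv_ne_zero
    obtain ⟨h1, h2, h3, h4⟩ := gen_conv (E q) (F q)
    obtain ⟨k1, k2, k3, k4⟩ := gen_conv (F q) (E q)
    obtain ⟨l1, l2, l3, l4⟩ := gen_conv (K q) (K q)
    obtain ⟨m1, m2, m3, m4⟩ := gen_conv (Kinv q) (Kinv q)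
    have e1 : (q.toC - q.toC⁻¹)⁻¹ * (q.toC - q.toC⁻¹) = 1 := inv_mul_cancel₀ hl
    simp only [smul_app, sub_app]
    cases s
    · rw [h1, k1, l1, m1]
      simp [K_gen, Kinv_gen, E, F, skew_gen, skewGen, torusGen, ← mul_inv, q.root_mul_root]
      linear_combination e1
    · rw [h2, k2, l2, m2]; simp [K_gen, Kinv_gen, E, F, skew_gen, skewGen, torusGen]
    · rw [h3, k3, l3, m3]; simp [K_gen, Kinv_gen, E, F, skew_gen, skewGen, torusGen]
    · rw [h4, k4, l4, m4]
      simp [K_gen, Kinv_gen, E, F, skew_gen, skewGen, torusGen, ← mul_inv, q.root_mul_root]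
      linear_combination -e1
  · have z : ∀ w, (0 : Fun q) w = 0 := fun w => rfl
    have kk := conv_mul_apply (K q) (K q) (K q) 0 0 (K q) (K q) (K q) 0 0
      (fun x y => by simp [K_mul]) (fun x y => by simp [K_mul]) x y
    have ll := conv_mul_apply (Kinv q) (Kinv q) (Kinv q) 0 0 (Kinv q) (Kinv q) (Kinv q) 0 0
      (fun x y => by simp [Kinv_mul]) (fun x y => by simp [Kinv_mul]) x y
    have ef := conv_mul_apply (E q) (E q) (K q) (Kinv q) (E q) (F q) (F q) (K q) (Kinv q) (F q)
      (skew_mul 0 1) (skew_mul 1 0) x y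
    have fe := conv_mul_apply (F q) (F q) (K q) (Kinv q) (F q) (E q) (E q) (K q) (Kinv q) (E q)
      (skew_mul 1 0) (skew_mul 0 1) x y
    simp only [zero_mul, mul_zero, z, add_zero] at kk ll
    rw [E_mul_Kinv, Kinv_mul_F] at ef
    rw [F_mul_K, K_mul_E] at fe
    simp only [smul_app, sub_app] at ef fe ⊢
    rw [ef, fe, kk, ll]
    ring


end Fun

/-- The generators `E, F, K, K⁻¹` of the quantized enveloping algebra. -/
inductive UGen : Type
  | E | F | K | Kinv

open FreeAlgebra in
/-- The defining relations of `U_q(su₂)`: `K K⁻¹ = K⁻¹ K = 1`, `KE = q EK`, `FK = q KF`,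
`EF - FE = (q - q⁻¹)⁻¹ (K² - K⁻²)`. -/
inductive URel (q : Param) : FreeAlgebra ℂ UGen → FreeAlgebra ℂ UGen → Prop
  | KKinv : URel q (ι ℂ .K * ι ℂ .Kinv) 1
  | KinvK : URel q (ι ℂ .Kinv * ι ℂ .K) 1
  | KE : URel q (ι ℂ .K * ι ℂ .E) (q.toC • (ι ℂ .E * ι ℂ .K))
  | FK : URel q (ι ℂ .F * ι ℂ .K) (q.toC • (ι ℂ .K * ι ℂ .F))
  | EF : URel q (ι ℂ .E * ι ℂ .F - ι ℂ .F * ι ℂ .E)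
      ((q.toC - q.toC⁻¹)⁻¹ • (ι ℂ .K * ι ℂ .K - ι ℂ .Kinv * ι ℂ .Kinv))

/-- The quantized enveloping algebra `U_q(su₂)`. -/
def Uq (q : Param) : Type := RingQuot (URel q)

namespace Uq

variable {q : Param}

noncomputable instance : Ring (Uq q) := inferInstanceAs (Ring (RingQuot (URel q)))

noncomputable instance : Algebra ℂ (Uq q) := inferInstanceAs (Algebra ℂ (RingQuot (URel q)))

/-- The generators as elements of `U_q(su₂)`. -/
noncomputable def gen (q : Param) (g : UGen) : Uq q :=
  RingQuot.mkAlgHom ℂ (URel q) (FreeAlgebra.ι ℂ g)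

/-- The generator `E` of `U_q(su₂)`. -/
noncomputable def E (q : Param) : Uq q := gen q .E
/-- The generator `F` of `U_q(su₂)`. -/
noncomputable def F (q : Param) : Uq q := gen q .F
/-- The generator `K` of `U_q(su₂)`. -/
noncomputable def K (q : Param) : Uq q := gen q .K
/-- The generator `K⁻¹` of `U_q(su₂)`. -/
noncomputable def Kinv (q : Param) : Uq q := gen q .Kinv

theorem gen_rel {s t : FreeAlgebra ℂ UGen} (h : URel q s t) :
    FreeAlgebra.lift ℂ (gen q) s = FreeAlgebra.lift ℂ (gen q) t := by
  have key : FreeAlgebra.lift ℂ (gen q) = RingQuot.mkAlgHom ℂ (URel q) := by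
    ext g; simp [gen]; rfl
  rw [key]
  exact RingQuot.mkAlgHom_rel ℂ h

theorem K_mul_Kinv : K q * Kinv q = 1 := by
  simpa [E, F, K, Kinv] using gen_rel (q := q) .KKinv

theorem Kinv_mul_K : Kinv q * K q = 1 := by
  simpa [E, F, K, Kinv] using gen_rel (q := q) .KinvK

theorem K_mul_E : K q * E q = q.toC • (E q * K q) := by
  simpa [E, F, K, Kinv] using gen_rel (q := q) .KE

theorem F_mul_K : F q * K q = q.toC • (K q * F q) := by
  simpa [E, F, K, Kinv] using gen_rel (q := q) .FK

theorem E_F_comm : E q * F q - F q * E q =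
    (q.toC - q.toC⁻¹)⁻¹ • (K q * K q - Kinv q * Kinv q) := by
  simpa [E, F, K, Kinv] using gen_rel (q := q) .EF

theorem E_mul_Kinv : E q * Kinv q = q.toC • (Kinv q * E q) := by
  calc E q * Kinv q = Kinv q * (K q * E q) * Kinv q := by
        rw [← mul_assoc, Kinv_mul_K, one_mul]
    _ = q.toC • (Kinv q * E q) := by
        rw [K_mul_E, mul_smul_comm, smul_mul_assoc, mul_assoc, mul_assoc, K_mul_Kinv, mul_one]

theorem Kinv_mul_F : Kinv q * F q = q.toC • (F q * Kinv q) := by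
  calc Kinv q * F q = Kinv q * (F q * K q) * Kinv q := by
        rw [mul_assoc, mul_assoc, K_mul_Kinv, mul_one]
    _ = q.toC • (F q * Kinv q) := by
        rw [F_mul_K, mul_smul_comm, smul_mul_assoc, ← mul_assoc, Kinv_mul_K, one_mul]

/-- The universal property of `U_q(su₂)`. -/
noncomputable def lift {X : Type*} [Ring X] [Algebra ℂ X] (f : UGen → X)
    (hf : ∀ ⦃s t : FreeAlgebra ℂ UGen⦄, URel q s t →
      FreeAlgebra.lift ℂ f s = FreeAlgebra.lift ℂ f t) : Uq q →ₐ[ℂ] X :=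
  RingQuot.liftAlgHom ℂ ⟨FreeAlgebra.lift ℂ f, hf⟩

@[simp]
theorem lift_gen {X : Type*} [Ring X] [Algebra ℂ X] (f : UGen → X)
    (hf : ∀ ⦃s t : FreeAlgebra ℂ UGen⦄, URel q s t →
      FreeAlgebra.lift ℂ f s = FreeAlgebra.lift ℂ f t) (g : UGen) :
    lift (q := q) f hf (gen q g) = f g :=
  (RingQuot.liftAlgHom_mkAlgHom_apply ℂ (FreeAlgebra.lift ℂ f) hf (FreeAlgebra.ι ℂ g)).trans
    (FreeAlgebra.lift_ι_apply f g)

theorem hom_ext {X : Type*} [Semiring X] [Algebra ℂ X] {φ ψ : Uq q →ₐ[ℂ] X}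
    (h : ∀ g, φ (gen q g) = ψ (gen q g)) : φ = ψ :=
  RingQuot.ringQuot_ext' ℂ φ ψ (FreeAlgebra.hom_ext (funext fun g => h g))

open MulOpposite in
/-- Values on generators of `antiHom`. -/
noncomputable def antiGen (q : Param) (z : ℂ) : UGen → (Uq q)ᵐᵒᵖ
  | .E => op (-z • E q)
  | .F => op (-z⁻¹ • F q)
  | .K => op (Kinv q)
  | .Kinv => op (K q)

open MulOpposite in
/-- The anti-homomorphism with `K ↦ K⁻¹`, `K⁻¹ ↦ K`, `E ↦ -z E`, `F ↦ -z⁻¹ F`. -/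
noncomputable def antiHom (q : Param) (z : ℂ) (hz : z ≠ 0) : Uq q →ₐ[ℂ] (Uq q)ᵐᵒᵖ :=
  lift (antiGen q z) (by
    intro s t h
    cases h
    · simp [antiGen, ← op_mul, K_mul_Kinv]
    · simp [antiGen, ← op_mul, Kinv_mul_K]
    · simp only [map_mul, map_smul, FreeAlgebra.lift_ι_apply, antiGen, ← op_mul, ← op_smul]
      rw [smul_mul_assoc, E_mul_Kinv, mul_smul_comm, smul_comm]
    · simp only [map_mul, map_smul, FreeAlgebra.lift_ι_apply, antiGen, ← op_mul, ← op_smul]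
      rw [mul_smul_comm, Kinv_mul_F, smul_mul_assoc, smul_comm]
    · have h1 : F q * E q - E q * F q =
          (q.toC - q.toC⁻¹)⁻¹ • (Kinv q * Kinv q - K q * K q) := by
        rw [← neg_sub, E_F_comm, ← smul_neg, neg_sub]
      simp [antiGen, ← op_mul, ← op_smul, ← op_sub, smul_smul, hz, h1])

open MulOpposite in
/-- The antipode `S` of `U_q(su₂)`, a bijective algebra anti-homomorphism:
`S(K) = K⁻¹`, `S(E) = -q E`, `S(F) = -q⁻¹ F`. -/
noncomputable def antipode (q : Param) : Uq q ≃ₐ[ℂ] (Uq q)ᵐᵒᵖ :=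
  AlgEquiv.ofAlgHom (antiHom q q.toC q.toC_ne_zero)
    (AlgHom.opComm (antiHom q q.toC⁻¹ (inv_ne_zero q.toC_ne_zero)))
    (by
      have h0 := q.toC_ne_zero
      refine AlgHom.opComm.symm.injective ?_
      refine hom_ext fun g => ?_
      cases g <;> simp [antiHom, antiGen, E, F, K, Kinv, smul_smul, h0])
    (by
      have h0 := q.toC_ne_zero
      refine hom_ext fun g => ?_
      cases g <;> simp [antiHom, antiGen, E, F, K, Kinv, smul_smul, h0])

/-- The inverse antipode `S⁻¹`. -/
noncomputable def antipodeInv (f : Uq q) : Uq q := (antipode q).symm (MulOpposite.op f)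

theorem antipodeInv_E : antipodeInv (E q) = -q.toC⁻¹ • E q := by
  simp [antipodeInv, antipode, antiHom, antiGen, E]

theorem antipodeInv_F : antipodeInv (F q) = -q.toC • F q := by
  simp [antipodeInv, antipode, antiHom, antiGen, F]

/-- The functionals on `O(SU_q(2))` defined by the generators. -/
noncomputable def pairGen (q : Param) : UGen → Fun q
  | .E => Fun.E q
  | .F => Fun.F q
  | .K => Fun.K q
  | .Kinv => Fun.Kinv q

/-- The algebra homomorphism `f ↦ ⟨f, ·⟩` from `U_q(su₂)` to the convolution algebra. -/
noncomputable def toDual (q : Param) : Uq q →ₐ[ℂ] Fun q :=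
  lift (pairGen q) (by
    intro s t h
    cases h <;> simp only [map_mul, map_sub, map_smul, map_one, FreeAlgebra.lift_ι_apply, pairGen]
    · exact Fun.K_mul_Kinv
    · exact Fun.Kinv_mul_K
    · exact Fun.K_mul_E
    · exact Fun.F_mul_K
    · exact Fun.E_F_comm)

/-- The dual pairing `⟨f, x⟩` of `U_q(su₂)` and `O(SU_q(2))`. -/
noncomputable def pairing (f : Uq q) : OSU q →ₗ[ℂ] ℂ := (toDual q f).ofConv

/-- The left action `f ▷ x = ⟨f, x₍₂₎⟩ x₍₁₎`. -/
noncomputable def leftAct (f : Uq q) : OSU q →ₗ[ℂ] OSU q :=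
  (TensorProduct.rid ℂ (OSU q)).toLinearMap ∘ₗ (pairing f).lTensor (OSU q) ∘ₗ
    Coalgebra.comul (R := ℂ)

/-- The right action `x ◁ f = ⟨f, x₍₁₎⟩ x₍₂₎`. -/
noncomputable def rightAct (f : Uq q) : OSU q →ₗ[ℂ] OSU q :=
  (TensorProduct.lid ℂ (OSU q)).toLinearMap ∘ₗ (pairing f).rTensor (OSU q) ∘ₗ
    Coalgebra.comul (R := ℂ)

/-- The operator `R_f(x) = x ◁ S⁻¹(f)`. -/
noncomputable def R (f : Uq q) : OSU q →ₗ[ℂ] OSU q := rightAct (antipodeInv f)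

theorem pairing_Kinv_sq : pairing (Kinv q ^ 2) =
    (Fun.torus q q.toC⁻¹ (inv_ne_zero q.toC_ne_zero)).toLinearMap := by
  have h : toDual q (Kinv q) = Fun.Kinv q := lift_gen _ _ _
  rw [pairing, map_pow, h, pow_two, Fun.Kinv, Fun.torus_conv]
  simp only [← mul_inv, q.root_mul_root]

theorem pairing_K_sq : pairing (K q ^ 2) = (Fun.torus q q.toC q.toC_ne_zero).toLinearMap := by
  have h : toDual q (K q) = Fun.K q := lift_gen _ _ _
  rw [pairing, map_pow, h, pow_two, Fun.K, Fun.torus_conv]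
  simp only [q.root_mul_root]

open OSU in
/-- The algebra homomorphism `x ↦ χ(x₍₂₎) x₍₁₎` given by the character `χ = torus q t`. -/
noncomputable def charAct (q : Param) (t : ℂ) (ht : t ≠ 0) : OSU q →ₐ[ℂ] OSU q :=
  (Algebra.TensorProduct.rid ℂ ℂ (OSU q)).toAlgHom.comp
    ((Algebra.TensorProduct.map (AlgHom.id ℂ (OSU q)) (Fun.torus q t ht)).comp (comulHom q))

theorem leftAct_of_torus {f : Uq q} {t : ℂ} (ht : t ≠ 0)
    (h : pairing f = (Fun.torus q t ht).toLinearMap) (x : OSU q) :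
    leftAct f x = charAct q t ht x := by
  rw [leftAct, h]; rfl

theorem charAct_gen (t : ℂ) (ht : t ≠ 0) (g : SUGen) : charAct q t ht (OSU.gen q g) =
    match g with
      | .a => t⁻¹ • OSU.gen q .a
      | .b => t • OSU.gen q .b
      | .c => t⁻¹ • OSU.gen q .c
      | .d => t • OSU.gen q .d := by
  cases g <;> simp [charAct, OSU.comulHom, OSU.comulGen, Fun.torus_gen, Fun.torusGen]

theorem charAct_charAct (t : ℂ) (ht : t ≠ 0) (x : OSU q) :
    charAct q t⁻¹ (inv_ne_zero ht) (charAct q t ht x) = x := by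
  have h : (charAct q t⁻¹ (inv_ne_zero ht)).comp (charAct q t ht) = AlgHom.id ℂ (OSU q) := by
    refine OSU.hom_ext fun g => ?_
    cases g <;> simp [charAct_gen, smul_smul, ht]
  exact DFunLike.congr_fun h x

end Uq

open OSU in
/-- The element `A = -q⁻¹ bc`. -/
noncomputable def genA (q : Param) : OSU q := -q.toC⁻¹ • (gen q .b * gen q .c)

open OSU in
/-- The element `B = ac`. -/
noncomputable def genB (q : Param) : OSU q := gen q .a * gen q .c

open OSU in
/-- The element `B* = -db`, which is the adjoint of `B` since `a* = d`, `c* = -q⁻¹ b`. -/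
noncomputable def genBstar (q : Param) : OSU q := -(gen q .d * gen q .b)

/-- The coordinate algebra `O(S_q²)` of the standard Podleś sphere: the unital subalgebra of
`O(SU_q(2))` generated by `A`, `B`, `B*`. (It is stable under the involution, as `A* = A`.) -/
noncomputable def podles (q : Param) : Subalgebra ℂ (OSU q) :=
  Algebra.adjoin ℂ {genA q, genB q, genBstar q}

theorem charAct_mem {q : Param} (t : ℂ) (ht : t ≠ 0) {x : OSU q} (hx : x ∈ podles q) :
    Uq.charAct q t ht x ∈ podles q := by
  have hle : podles q ≤ (podles q).comap (Uq.charAct q t ht) := by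
    refine Algebra.adjoin_le ?_
    rintro y (rfl | rfl | rfl)
    · have : Uq.charAct q t ht (genA q) = genA q := by
        simp [genA, Uq.charAct_gen, smul_smul, ht]
      change Uq.charAct q t ht (genA q) ∈ podles q
      rw [this]; exact Algebra.subset_adjoin (by simp)
    · have : Uq.charAct q t ht (genB q) = (t⁻¹ * t⁻¹) • genB q := by
        simp [genB, Uq.charAct_gen, smul_smul]
      change Uq.charAct q t ht (genB q) ∈ podles q
      rw [this]; exact Subalgebra.smul_mem _ (Algebra.subset_adjoin (by simp)) _
    · have : Uq.charAct q t ht (genBstar q) = (t * t) • genBstar q := by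
        simp [genBstar, Uq.charAct_gen, smul_smul]
      change Uq.charAct q t ht (genBstar q) ∈ podles q
      rw [this]; exact Subalgebra.smul_mem _ (Algebra.subset_adjoin (by simp)) _
  exact hle hx

theorem leftAct_Kinv_sq (q : Param) (x : OSU q) : Uq.leftAct (Uq.Kinv q ^ 2) x =
    Uq.charAct q q.toC⁻¹ (inv_ne_zero q.toC_ne_zero) x :=
  Uq.leftAct_of_torus _ Uq.pairing_Kinv_sq x

theorem leftAct_K_sq (q : Param) (x : OSU q) : Uq.leftAct (Uq.K q ^ 2) x =
    Uq.charAct q q.toC q.toC_ne_zero x :=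
  Uq.leftAct_of_torus _ Uq.pairing_K_sq x

/-- The algebra automorphism `σ(x) = K⁻² ▷ x` of `O(S_q²)`, with inverse `x ↦ K² ▷ x`. -/
noncomputable def sigma (q : Param) : podles q ≃ₐ[ℂ] podles q where
  toFun x := ⟨Uq.leftAct (Uq.Kinv q ^ 2) x, by
    rw [leftAct_Kinv_sq]; exact charAct_mem _ _ x.2⟩
  invFun x := ⟨Uq.leftAct (Uq.K q ^ 2) x, by
    rw [leftAct_K_sq]; exact charAct_mem _ _ x.2⟩
  left_inv x := Subtype.ext (by
    have h := Uq.charAct_charAct q.toC⁻¹ (inv_ne_zero q.toC_ne_zero) (x : OSU q)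
    simpa only [leftAct_Kinv_sq, leftAct_K_sq, inv_inv] using h)
  right_inv x := Subtype.ext (by
    simpa only [leftAct_Kinv_sq, leftAct_K_sq] using
      Uq.charAct_charAct q.toC q.toC_ne_zero (x : OSU q))
  map_mul' x y := Subtype.ext (by simp [leftAct_Kinv_sq])
  map_add' x y := Subtype.ext (by simp)
  commutes' r := Subtype.ext (by
    simp only [leftAct_Kinv_sq]
    exact AlgHom.commutes _ r)

/-- `h` is the Haar state of `O(SU_q(2))`: the normalized linear functional which is left and right
invariant, `h(x₍₂₎) x₍₁₎ = h(x) 1 = h(x₍₁₎) x₍₂₎`. -/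
def IsHaarState {q : Param} (h : OSU q →ₗ[ℂ] ℂ) : Prop :=
  h 1 = 1 ∧
  (∀ x, TensorProduct.rid ℂ (OSU q) (h.lTensor (OSU q) (Coalgebra.comul x)) = h x • 1) ∧
  (∀ x, TensorProduct.lid ℂ (OSU q) (h.rTensor (OSU q) (Coalgebra.comul x)) = h x • 1)

section Twisted

variable {X : Type*} [Ring X] [Algebra ℂ X]

/-- The `σ`-twisted coboundary of an `(n+1)`-linear form `φ`,
`(b_σ φ)(x₀, …, x_{n+1}) = ∑_{j=0}^{n} (-1)^j φ(x₀, …, x_j x_{j+1}, …, x_{n+1})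
  + (-1)^{n+1} φ(σ(x_{n+1}) x₀, x₁, …, x_n)`. -/
def twistedCoboundary (σ : X ≃ₐ[ℂ] X) {n : ℕ}
    (φ : MultilinearMap ℂ (fun _ : Fin (n + 1) => X) ℂ) (x : Fin (n + 2) → X) : ℂ :=
  ∑ j : Fin (n + 1), (-1) ^ (j : ℕ) * φ (Fin.contractNth j.castSucc (· * ·) x) +
    (-1) ^ (n + 1) * φ (Fin.cons (σ (x (Fin.last (n + 1))) * x 0)
      fun i : Fin n => x i.succ.castSucc)

/-- The `σ`-twisted cyclicity operator on `(n+1)`-linear forms,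
`(λ_σ φ)(x₀, …, x_n) = (-1)^n φ(σ(x_n), x₀, …, x_{n-1})`. -/
def twistedCyclicity (σ : X ≃ₐ[ℂ] X) {n : ℕ}
    (φ : MultilinearMap ℂ (fun _ : Fin (n + 1) => X) ℂ) (x : Fin (n + 1) → X) : ℂ :=
  (-1) ^ n * φ (Fin.cons (σ (x (Fin.last n))) fun i : Fin n => x i.castSucc)

/-- `φ` is a `σ`-twisted cyclic `n`-cocycle: `b_σ φ = 0` and `λ_σ φ = φ`. -/
def IsTwistedCyclicCocycle (σ : X ≃ₐ[ℂ] X) {n : ℕ}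
    (φ : MultilinearMap ℂ (fun _ : Fin (n + 1) => X) ℂ) : Prop :=
  (∀ x, twistedCoboundary σ φ x = 0) ∧ ∀ x, twistedCyclicity σ φ x = φ x

/-- `φ`, an `(n+2)`-linear form (so of degree `n+1`), is not of the form `b_σ ψ` with an
`(n+1)`-linear form `ψ` such that `λ_σ ψ = ψ`. -/
def IsNontrivial (σ : X ≃ₐ[ℂ] X) {n : ℕ}
    (φ : MultilinearMap ℂ (fun _ : Fin (n + 2) => X) ℂ) : Prop :=
  ¬ ∃ ψ : MultilinearMap ℂ (fun _ : Fin (n + 1) => X) ℂ,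
    (∀ x, φ x = twistedCoboundary σ ψ x) ∧ ∀ x, twistedCyclicity σ ψ x = ψ x

end Twisted

open Uq in
/-- The form `τ(x₀, x₁, x₂) = h(x₀ (R_F(x₁) R_E(x₂) - q² R_E(x₁) R_F(x₂)))` on `O(S_q²)`. -/
noncomputable def tau (q : Param) (h : OSU q →ₗ[ℂ] ℂ) :
    MultilinearMap ℂ (fun _ : Fin 3 => podles q) ℂ where
  toFun x := h ((x 0 : OSU q) *
    (R (F q) (x 1) * R (E q) (x 2) - q.toC ^ 2 • (R (E q) (x 1) * R (F q) (x 2))))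
  map_update_add' := by
    intro inst m i x y
    obtain rfl : inst = instDecidableEqFin 3 := Subsingleton.elim _ _
    obtain rfl | rfl | rfl : i = 0 ∨ i = 1 ∨ i = 2 := by lia
    · simp [add_mul]
    · simp [mul_add, add_mul, mul_sub]; ring
    · simp [mul_add, mul_sub]; ring
  map_update_smul' := by
    intro inst m i c x
    obtain rfl : inst = instDecidableEqFin 3 := Subsingleton.elim _ _
    obtain rfl | rfl | rfl : i = 0 ∨ i = 1 ∨ i = 2 := by lia
    · simp
    · simp [mul_sub]; ring
    · simp [mul_sub]; ring

end QSphere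

/-!
The Haar state comes from an explicit model. Embed `O(SU_q(2))` in the algebra with basis
`u ^ n b ^ j c ^ k` by `a = u`, `d = u⁻¹ (1 + q bc)`; then `h` keeps the coefficients of
`b ^ k c ^ k` and weighs them by `moment q k`. The weights satisfy the one recursion that makes `h`
vanish on the image of the right action of `E` (`haar_rightAct_E`), and `h` is visibly invariant
under `K`. Modulo the images of `E` and `K - 1` every monomial is a scalar, and the slice map
`x ↦ h(x₍₁₎) x₍₂₎` kills these images, so `h` is invariant on one side (`slice_haar`). The
symmetry `b ↔ c` reverses the comultiplication and turns `h` into a functional invariant on the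
other side; a left and a right invariant state always coincide (`eq_of_invariant`), which gives
two-sided invariance and uniqueness at once.

The recursion for the weights also gives `h(ya) = q² h(ay)` and `h(yd) = q⁻² h(dy)`, while `b` and
`c` can be moved around freely. Hence `h(yx) = h(σ(x) y)` for `x` in the Podleś sphere
(`haar_mul_podles`). As `K` acts trivially there from the right, `E` and `F` act as commuting
derivations into `O(SU_q(2))`. The cocycle identity follows from the Leibniz rule and the modular
property, cyclicity from integration by parts.

For non-triviality, `τ` is paired with the idempotent `p = v w`, where `v = (a, b)` and
`w = (d, -q⁻¹ c)`. The automorphism `σ` acts on `p` by conjugation with `ρ = diag(q², 1)`, so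
`∑ ρᵢ φ(pᵢⱼ, pⱼₖ, pₖᵢ) = 0` for the twisted coboundary `φ` of a cyclic form
(`sum_eq_zero_of_eq_twistedCoboundary`), whereas the sum for `τ` is `q²`
(`sum_bottWeight_mul_tau_bott`).
-/

namespace QSphere

/-! ### Monomials in the coordinate algebra -/

theorem Param.toC_eq (q : Param) : q.toC = q.root * q.root := q.root_mul_root.symm

namespace OSU

variable {q : Param}

theorem ab : gen q .a * gen q .b = q.toC • (gen q .b * gen q .a) := by
  rw [ba, smul_inv_smul₀ q.toC_ne_zero]

theorem ac : gen q .a * gen q .c = q.toC • (gen q .c * gen q .a) := by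
  rw [ca, smul_inv_smul₀ q.toC_ne_zero]

/-- The ordered monomial `b ^ j c ^ k`. -/
noncomputable def bc (q : Param) (j k : ℕ) : OSU q := gen q .b ^ j * gen q .c ^ k

theorem b_mul_bc (j k : ℕ) : gen q .b * bc q j k = bc q (j + 1) k := by
  rw [bc, bc, pow_succ', mul_assoc]

theorem c_mul_bc (j k : ℕ) : gen q .c * bc q j k = bc q j (k + 1) := by
  rw [bc, bc, pow_succ' _ k, ← mul_assoc, ← mul_assoc,
    ((show Commute (gen q .c) (gen q .b) from cb).pow_right j).eq]

theorem bc_mul_b (j k : ℕ) : bc q j k * gen q .b = bc q (j + 1) k := by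
  rw [bc, bc, mul_assoc, ((show Commute (gen q .c) (gen q .b) from cb).pow_left k).eq, ← mul_assoc,
    pow_succ]

theorem bc_mul_c (j k : ℕ) : bc q j k * gen q .c = bc q j (k + 1) := by
  rw [bc, bc, mul_assoc, pow_succ]

theorem mul_pow_of_mul_eq_smul {X : Type*} [Ring X] [Algebra ℂ X] {x y : X} {r : ℂ}
    (h : x * y = r • (y * x)) (n : ℕ) : x * y ^ n = r ^ n • (y ^ n * x) := by
  induction n with
  | zero => simp
  | succ n ih =>
    rw [pow_succ, ← mul_assoc, ih, smul_mul_assoc, mul_assoc, h, mul_smul_comm, smul_smul,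
      ← mul_assoc, pow_succ]

theorem mul_bc_of_mul_eq_smul {x : OSU q} {r : ℂ} (hb : x * gen q .b = r • (gen q .b * x))
    (hc : x * gen q .c = r • (gen q .c * x)) (j k : ℕ) :
    x * bc q j k = r ^ (j + k) • (bc q j k * x) := by
  rw [bc, ← mul_assoc, mul_pow_of_mul_eq_smul hb, smul_mul_assoc, mul_assoc,
    mul_pow_of_mul_eq_smul hc, mul_smul_comm, smul_smul, mul_assoc, pow_add]

theorem a_mul_bc (j k : ℕ) : gen q .a * bc q j k = q.toC ^ (j + k) • (bc q j k * gen q .a) :=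
  mul_bc_of_mul_eq_smul ab ac j k

theorem d_mul_bc (j k : ℕ) : gen q .d * bc q j k = q.toC⁻¹ ^ (j + k) • (bc q j k * gen q .d) :=
  mul_bc_of_mul_eq_smul db dc j k

theorem bc_mul_ad (j k : ℕ) :
    bc q j k * (gen q .a * gen q .d) = bc q j k + q.toC • bc q (j + 1) (k + 1) := by
  rw [ad, mul_add, mul_one, mul_smul_comm, ← mul_assoc, bc_mul_b, bc_mul_c]

theorem bc_mul_da (j k : ℕ) :
    bc q j k * (gen q .d * gen q .a) = bc q j k + q.toC⁻¹ • bc q (j + 1) (k + 1) := by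
  rw [da, mul_add, mul_one, mul_smul_comm, ← mul_assoc, bc_mul_b, bc_mul_c]

/-- The monomials `b ^ j c ^ k a ^ i` and `b ^ j c ^ k d ^ i` span `O(SU_q(2))`. -/
theorem mem_of_monomials {S : Submodule ℂ (OSU q)} (ha : ∀ i j k, bc q j k * gen q .a ^ i ∈ S)
    (hd : ∀ i j k, bc q j k * gen q .d ^ i ∈ S) (x : OSU q) : x ∈ S := by
  set T : Submodule ℂ (OSU q) := Submodule.span ℂ
    (Set.range (fun p : ℕ × ℕ × ℕ => bc q p.2.1 p.2.2 * gen q .a ^ p.1) ∪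
      Set.range fun p : ℕ × ℕ × ℕ => bc q p.2.1 p.2.2 * gen q .d ^ p.1) with hT
  have ha' : ∀ i j k, bc q j k * gen q .a ^ i ∈ T := fun i j k =>
    Submodule.subset_span (Or.inl ⟨(i, j, k), rfl⟩)
  have hd' : ∀ i j k, bc q j k * gen q .d ^ i ∈ T := fun i j k =>
    Submodule.subset_span (Or.inr ⟨(i, j, k), rfl⟩)
  have hTS : T ≤ S := by
    refine Submodule.span_le.mpr ?_
    rintro _ (⟨p, rfl⟩ | ⟨p, rfl⟩)
    exacts [ha _ _ _, hd _ _ _]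
  have hgen : ∀ g y, y ∈ T → gen q g * y ∈ T := by
    intro g y hy
    have hle : T ≤ T.comap (LinearMap.mulLeft ℂ (gen q g)) := by
      refine Submodule.span_le.mpr ?_
      rintro _ (⟨⟨i, j, k⟩, rfl⟩ | ⟨⟨i, j, k⟩, rfl⟩) <;>
        simp only [SetLike.mem_coe, Submodule.mem_comap, LinearMap.mulLeft_apply] <;>
        rw [← mul_assoc] <;> cases g
      · rw [a_mul_bc, smul_mul_assoc, mul_assoc, ← pow_succ']
        exact T.smul_mem _ (ha' _ _ _)
      · rw [b_mul_bc]; exact ha' _ _ _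
      · rw [c_mul_bc]; exact ha' _ _ _
      · rw [d_mul_bc, smul_mul_assoc]
        refine T.smul_mem _ ?_
        cases i with
        | zero => simpa using hd' 1 j k
        | succ i =>
          rw [pow_succ', mul_assoc, ← mul_assoc (gen q .d), ← mul_assoc, bc_mul_da, add_mul,
            smul_mul_assoc]
          exact T.add_mem (ha' _ _ _) (T.smul_mem _ (ha' _ _ _))
      · rw [a_mul_bc, smul_mul_assoc]
        refine T.smul_mem _ ?_
        cases i with
        | zero => simpa using ha' 1 j k
        | succ i =>
          rw [pow_succ', mul_assoc, ← mul_assoc (gen q .a), ← mul_assoc, bc_mul_ad, add_mul,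
            smul_mul_assoc]
          exact T.add_mem (hd' _ _ _) (T.smul_mem _ (hd' _ _ _))
      · rw [b_mul_bc]; exact hd' _ _ _
      · rw [c_mul_bc]; exact hd' _ _ _
      · rw [d_mul_bc, smul_mul_assoc, mul_assoc, ← pow_succ']
        exact T.smul_mem _ (hd' _ _ _)
    exact hle hy
  have key : ∀ y ∈ T, x * y ∈ T := by
    induction x using OSU.induction with
    | halg r =>
      intro y hy
      rw [Algebra.algebraMap_eq_smul_one, smul_mul_assoc, one_mul]
      exact T.smul_mem r hy
    | hgen g => exact hgen g
    | hmul x y hx hy => intro z hz; rw [mul_assoc]; exact hx _ (hy _ hz)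
    | hadd x y hx hy => intro z hz; rw [add_mul]; exact T.add_mem (hx _ hz) (hy _ hz)
  have h1 : (1 : OSU q) ∈ T := by simpa [bc] using ha' 0 0 0
  simpa using hTS (key 1 h1)

theorem linearMap_ext_monomials {M : Type*} [AddCommGroup M] [Module ℂ M]
    {f g : OSU q →ₗ[ℂ] M}
    (ha : ∀ i j k, f (bc q j k * gen q .a ^ i) = g (bc q j k * gen q .a ^ i))
    (hd : ∀ i j k, f (bc q j k * gen q .d ^ i) = g (bc q j k * gen q .d ^ i)) : f = g := by
  ext x
  exact mem_of_monomials (S := LinearMap.eqLocus f g) ha hd x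

end OSU

/-! ### A functional on the coordinate algebra -/

/-- The numbers with `qint t 0 = 0` and `qint t (k + 1) = t ^ 3 * qint t k + t⁻¹ ^ k`, that is
`t ^ (k - 1) (t ^ (2 k) - t ^ (-2 k)) / (t ^ 2 - t ^ (-2))`: a rescaled quantum integer for the
parameter `t ^ 2`. -/
noncomputable def qint (t : ℂ) : ℕ → ℂ
  | 0 => 0
  | k + 1 => t ^ 3 * qint t k + t⁻¹ ^ k

theorem qint_succ (t : ℂ) (k : ℕ) : qint t (k + 1) = t ^ 3 * qint t k + t⁻¹ ^ k := rfl

/-- The mirror recursion, reflecting the symmetry of quantum integers under `t ↦ t⁻¹`. -/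
theorem qint_succ' (t : ℂ) (k : ℕ) :
    qint t (k + 1) = t⁻¹ * qint t k + t ^ (3 * k) := by
  induction k with
  | zero => simp [qint]
  | succ k ih =>
    rw [qint_succ t (k + 1)]
    linear_combination t ^ 3 * ih - t⁻¹ * qint_succ t k

theorem qint_pos {t : ℝ} (ht : 0 < t) (k : ℕ) : ∃ r : ℝ, 0 < r ∧ qint t (k + 1) = r := by
  induction k with
  | zero => exact ⟨1, one_pos, by simp [qint]⟩
  | succ k ih =>
    obtain ⟨r, hr, h⟩ := ih
    refine ⟨t ^ 3 * r + t⁻¹ ^ (k + 1), by positivity, ?_⟩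
    rw [qint_succ, h]
    push_cast
    ring

namespace Param

theorem qint_ne_zero (q : Param) (k : ℕ) : qint q.root (k + 1) ≠ 0 := by
  obtain ⟨r, hr, h⟩ := qint_pos (Real.sqrt_pos.mpr q.2.1) k
  rw [root, h]
  exact Complex.ofReal_ne_zero.mpr hr.ne'

end Param

/-- The values `h(b ^ k c ^ k)` of the Haar state. -/
noncomputable def moment (q : Param) (k : ℕ) : ℂ := (-q.root) ^ k / qint q.root (k + 1)

theorem moment_zero (q : Param) : moment q 0 = 1 := by simp [moment, qint]

theorem qint_mul_moment (q : Param) (k : ℕ) :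
    qint q.root (k + 2) * moment q (k + 1) = -q.root * qint q.root (k + 1) * moment q k := by
  have h1 := q.qint_ne_zero k
  have h2 := q.qint_ne_zero (k + 1)
  rw [moment, moment]
  field_simp
  ring

/-- The generators of `O(SU_q(2))` as operators on functions of `(n, j, k)`. Embed `O(SU_q(2))` in
the algebra with basis `u ^ n b ^ j c ^ k`, `ub = q bu`, `uc = q cu`, by `a = u`,
`d = u⁻¹ (1 + q bc)`; a function is a functional on that algebra, and `x` acts on it by
`(x f)(y) = f(yx)`. -/
noncomputable def dualGen (q : Param) : SUGen → Module.End ℂ (ℤ → ℕ → ℕ → ℂ)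
  | .a => { toFun := fun f n j k => q.toC⁻¹ ^ (j + k) * f (n + 1) j k
            map_add' := fun f g => by ext; simp [mul_add]
            map_smul' := fun r f => by ext; simp [mul_left_comm] }
  | .b => { toFun := fun f n j k => f n (j + 1) k
            map_add' := fun f g => rfl
            map_smul' := fun r f => rfl }
  | .c => { toFun := fun f n j k => f n j (k + 1)
            map_add' := fun f g => rfl
            map_smul' := fun r f => rfl }
  | .d => { toFun := fun f n j k =>
              q.toC ^ (j + k) * (f (n - 1) j k + q.toC * f (n - 1) (j + 1) (k + 1))
            map_add' := fun f g => by ext; simp; ring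
            map_smul' := fun r f => by ext; simp; ring }

/-- The representation of `O(SU_q(2))` given by `dualGen`. -/
noncomputable def dualRep (q : Param) : OSU q →ₐ[ℂ] Module.End ℂ (ℤ → ℕ → ℕ → ℂ) :=
  OSU.lift (dualGen q) (by
    have h0 := q.toC_ne_zero
    intro s t h
    cases h <;> ext f n j k <;> simp [dualGen] <;> field_simp <;> ring)

theorem dualRep_gen (q : Param) (g : SUGen) : dualRep q (OSU.gen q g) = dualGen q g :=
  OSU.lift_gen _ _ g

/-- The functional on the skew Laurent algebra that defines the Haar state. -/
noncomputable def haarSeed (q : Param) : ℤ → ℕ → ℕ → ℂ := fun n j k =>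
  if n = 0 ∧ j = k then moment q k else 0

/-- The Haar state of `O(SU_q(2))`: it maps `b ^ k c ^ k` to `moment q k` and vanishes on the other
monomials. -/
noncomputable def haar (q : Param) : OSU q →ₗ[ℂ] ℂ where
  toFun x := dualRep q x (haarSeed q) 0 0 0
  map_add' x y := by simp
  map_smul' r x := by simp

open OSU

variable {q : Param}

theorem dualRep_bc (j k : ℕ) (f : ℤ → ℕ → ℕ → ℂ) (n : ℤ) (j' k' : ℕ) :
    dualRep q (bc q j k) f n j' k' = f n (j' + j) (k' + k) := by
  have hb : ∀ (j : ℕ) (f : ℤ → ℕ → ℕ → ℂ) (j' k' : ℕ),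
      (dualGen q .b ^ j) f n j' k' = f n (j' + j) k' := by
    intro j
    induction j with
    | zero => simp
    | succ j ih =>
      intro f j' k'
      rw [pow_succ, Module.End.mul_apply, ih, add_comm j 1, ← add_assoc, add_right_comm]
      rfl
  have hc : ∀ (k : ℕ) (f : ℤ → ℕ → ℕ → ℂ) (j' k' : ℕ),
      (dualGen q .c ^ k) f n j' k' = f n j' (k' + k) := by
    intro k
    induction k with
    | zero => simp
    | succ k ih =>
      intro f j' k'
      rw [pow_succ, Module.End.mul_apply, ih, add_comm k 1, ← add_assoc, add_right_comm]
      rfl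
  rw [bc, map_mul, map_pow, map_pow, dualRep_gen, dualRep_gen, Module.End.mul_apply, hb, hc]

theorem haar_bc_mul (j k : ℕ) (x : OSU q) :
    haar q (bc q j k * x) = dualRep q x (haarSeed q) 0 j k := by
  change dualRep q (bc q j k * x) (haarSeed q) 0 0 0 = _
  rw [map_mul, Module.End.mul_apply, dualRep_bc, zero_add, zero_add]

theorem haar_bc (j k : ℕ) : haar q (bc q j k) = if j = k then moment q k else 0 := by
  have h := haar_bc_mul (q := q) j k 1
  rw [mul_one, map_one] at h
  simpa [haarSeed] using h

theorem haar_one : haar q 1 = 1 := by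
  have h := haar_bc (q := q) 0 0
  simpa [bc, moment_zero] using h

theorem haar_bc_mul_a_pow (j k i : ℕ) : haar q (bc q j k * gen q .a ^ (i + 1)) = 0 := by
  have h : ∀ (i : ℕ) (n : ℤ) (j k : ℕ), n + i ≠ 0 →
      (dualGen q .a ^ i) (haarSeed q) n j k = 0 := by
    intro i
    induction i with
    | zero => intro n j k hn; simp_all [haarSeed]
    | succ i ih =>
      intro n j k hn
      rw [pow_succ', Module.End.mul_apply]
      change _ * (dualGen q .a ^ i) (haarSeed q) (n + 1) j k = 0
      rw [ih _ _ _ (by push_cast at hn; intro h; apply hn; linarith), mul_zero]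
  rw [haar_bc_mul, map_pow, dualRep_gen]
  exact h _ _ _ _ (by positivity)

theorem haar_bc_mul_d_pow (j k i : ℕ) : haar q (bc q j k * gen q .d ^ (i + 1)) = 0 := by
  have h : ∀ (i : ℕ) (n : ℤ) (j k : ℕ), n ≠ i →
      (dualGen q .d ^ i) (haarSeed q) n j k = 0 := by
    intro i
    induction i with
    | zero => intro n j k hn; simp_all [haarSeed]
    | succ i ih =>
      intro n j k hn
      have hn' : n - 1 ≠ i := by push_cast at hn; intro h; apply hn; linarith
      rw [pow_succ', Module.End.mul_apply]
      change _ * ((dualGen q .d ^ i) (haarSeed q) (n - 1) j k +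
        _ * (dualGen q .d ^ i) (haarSeed q) (n - 1) (j + 1) (k + 1)) = 0
      rw [ih _ _ _ hn', ih _ _ _ hn', mul_zero, add_zero, mul_zero]
  rw [haar_bc_mul, map_pow, dualRep_gen]
  exact h _ _ _ _ (by push_cast; positivity)

open WithConv
open Uq (pairing rightAct R K Kinv E F)

/-! ### Slice maps and actions -/

/-- The slice map `x ↦ f(x₍₁₎) x₍₂₎`. -/
noncomputable def slice (f : OSU q →ₗ[ℂ] ℂ) : OSU q →ₗ[ℂ] OSU q :=
  (TensorProduct.lid ℂ (OSU q)).toLinearMap ∘ₗ f.rTensor (OSU q) ∘ₗ Coalgebra.comul (R := ℂ)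

/-- The slice map `x ↦ f(x₍₂₎) x₍₁₎` on the other leg. -/
noncomputable def coslice (f : OSU q →ₗ[ℂ] ℂ) : OSU q →ₗ[ℂ] OSU q :=
  (TensorProduct.rid ℂ (OSU q)).toLinearMap ∘ₗ f.lTensor (OSU q) ∘ₗ Coalgebra.comul (R := ℂ)

theorem conv_apply_eq_apply_slice (f g : OSU q →ₗ[ℂ] ℂ) (x : OSU q) :
    (toConv f * toConv g : Fun q) x = g (slice f x) := by
  simp only [LinearMap.convMul_apply, slice, LinearMap.comp_apply]
  generalize Coalgebra.comul (R := ℂ) x = X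
  induction X with
  | zero => simp
  | add X Y hX hY => simp only [map_add, hX, hY]
  | tmul x y => simp

theorem conv_apply_eq_apply_coslice (f g : OSU q →ₗ[ℂ] ℂ) (x : OSU q) :
    (toConv f * toConv g : Fun q) x = f (coslice g x) := by
  simp only [LinearMap.convMul_apply, coslice, LinearMap.comp_apply]
  generalize Coalgebra.comul (R := ℂ) x = X
  induction X with
  | zero => simp
  | add X Y hX hY => simp only [map_add, hX, hY]
  | tmul x y => simp [mul_comm]

theorem slice_slice (f g : OSU q →ₗ[ℂ] ℂ) (x : OSU q) :
    slice g (slice f x) = slice (toConv f * toConv g : Fun q).ofConv x := by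
  have h1 : ∀ T : OSU q ⊗[ℂ] OSU q,
      TensorProduct.lid ℂ _ (g.rTensor (OSU q)
        (Coalgebra.comul (R := ℂ) (TensorProduct.lid ℂ _ (f.rTensor (OSU q) T)))) =
      TensorProduct.lid ℂ _ (f.rTensor _ ((TensorProduct.lid ℂ _).toLinearMap.lTensor _
        ((g.rTensor (OSU q)).lTensor (OSU q)
          ((Coalgebra.comul (R := ℂ)).lTensor (OSU q) T)))) := by
    intro T
    induction T with
    | zero => simp
    | add X Y hX hY => simp only [map_add, hX, hY]
    | tmul x y => simp
  have h2 : ∀ W : (OSU q ⊗[ℂ] OSU q) ⊗[ℂ] OSU q,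
      TensorProduct.lid ℂ _ (f.rTensor _ ((TensorProduct.lid ℂ _).toLinearMap.lTensor _
        ((g.rTensor (OSU q)).lTensor (OSU q) (TensorProduct.assoc ℂ _ _ _ W)))) =
      TensorProduct.lid ℂ _
        ((LinearMap.mul' ℂ ℂ ∘ₗ TensorProduct.map f g).rTensor (OSU q) W) := by
    intro W
    induction W with
    | zero => simp
    | add X Y hX hY => simp only [map_add, hX, hY]
    | tmul X z =>
      induction X with
      | zero => simp
      | add X Y hX hY => simp only [map_add, TensorProduct.add_tmul, hX, hY]
      | tmul x y => simp [smul_smul, mul_comm]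
  have h3 : (toConv f * toConv g : Fun q).ofConv =
    (LinearMap.mul' ℂ ℂ ∘ₗ TensorProduct.map f g) ∘ₗ Coalgebra.comul (R := ℂ) := rfl
  simp only [slice, LinearMap.comp_apply, LinearEquiv.coe_coe]
  rw [h1, ← Coalgebra.coassoc_apply, h2, h3, LinearMap.rTensor_comp _ _ (Coalgebra.comul (R := ℂ)),
    LinearMap.comp_apply]

theorem slice_mul {f f₁ f₁' f₂ f₂' : OSU q →ₗ[ℂ] ℂ}
    (hf : ∀ x y, f (x * y) = f₁ x * f₁' y + f₂ x * f₂' y) (x y : OSU q) :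
    slice f (x * y) = slice f₁ x * slice f₁' y + slice f₂ x * slice f₂' y := by
  simp only [slice, LinearMap.comp_apply, Bialgebra.comul_mul]
  generalize Coalgebra.comul (R := ℂ) x = X
  generalize Coalgebra.comul (R := ℂ) y = Y
  induction X with
  | zero => simp
  | add X₁ X₂ h₁ h₂ => simp only [add_mul, map_add, h₁, h₂]; abel
  | tmul x₁ x₂ =>
    induction Y with
    | zero => simp
    | add Y₁ Y₂ h₁ h₂ => simp only [mul_add, map_add, h₁, h₂]; abel
    | tmul y₁ y₂ => simp [hf, add_smul, smul_smul, mul_comm]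

theorem pairing_K : pairing (K q) = (Fun.K q).ofConv := congrArg ofConv (Uq.lift_gen _ _ _)

theorem pairing_Kinv : pairing (Kinv q) = (Fun.Kinv q).ofConv := congrArg ofConv (Uq.lift_gen _ _ _)

theorem pairing_E : pairing (E q) = (Fun.E q).ofConv := congrArg ofConv (Uq.lift_gen _ _ _)

theorem pairing_F : pairing (F q) = (Fun.F q).ofConv := congrArg ofConv (Uq.lift_gen _ _ _)

theorem pairing_one (x : OSU q) : pairing (1 : Uq q) x = Coalgebra.counit (R := ℂ) x := by
  rw [pairing, map_one]
  rfl

theorem rightAct_eq_slice (f : Uq q) : rightAct f = slice (pairing f) := rfl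

theorem rightAct_rightAct (f g : Uq q) (x : OSU q) :
    rightAct g (rightAct f x) = rightAct (f * g) x := by
  rw [rightAct_eq_slice, rightAct_eq_slice, slice_slice, rightAct_eq_slice, pairing, pairing,
    pairing, map_mul]

theorem rightAct_smul (r : ℂ) (f : Uq q) (x : OSU q) :
    rightAct (r • f) x = r • rightAct f x := by
  have h : pairing (r • f) = r • pairing f := by rw [pairing, map_smul]; rfl
  rw [rightAct, h, LinearMap.rTensor_smul]
  simp [rightAct]

theorem rightAct_sub (f g : Uq q) (x : OSU q) :
    rightAct (f - g) x = rightAct f x - rightAct g x := by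
  have h : pairing (f - g) = pairing f - pairing g := by rw [pairing, map_sub]; rfl
  rw [rightAct, h, LinearMap.rTensor_sub]
  simp [rightAct]

theorem rightAct_one (x : OSU q) : rightAct (1 : Uq q) x = x := by
  have h : pairing (1 : Uq q) = Coalgebra.counit (R := ℂ) := LinearMap.ext pairing_one
  rw [rightAct, h]
  simp

theorem rightAct_K_mul (x y : OSU q) :
    rightAct (K q) (x * y) = rightAct (K q) x * rightAct (K q) y := by
  have h := slice_mul (f := pairing (K q)) (f₁ := pairing (K q)) (f₁' := pairing (K q)) (f₂ := 0)
    (f₂' := 0) (fun x y => by simpa [pairing_K] using Fun.K_mul x y) x y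
  simpa [rightAct_eq_slice, slice] using h

theorem rightAct_Kinv_mul (x y : OSU q) :
    rightAct (Kinv q) (x * y) = rightAct (Kinv q) x * rightAct (Kinv q) y := by
  have h := slice_mul (f := pairing (Kinv q)) (f₁ := pairing (Kinv q))
    (f₁' := pairing (Kinv q)) (f₂ := 0)
    (f₂' := 0) (fun x y => by simpa [pairing_Kinv] using Fun.Kinv_mul x y) x y
  simpa [rightAct_eq_slice, slice] using h

theorem rightAct_E_mul (x y : OSU q) : rightAct (E q) (x * y) =
    rightAct (E q) x * rightAct (K q) y + rightAct (Kinv q) x * rightAct (E q) y := by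
  refine slice_mul (fun x y => ?_) x y
  rw [pairing_E, pairing_K, pairing_Kinv]
  exact Fun.skew_mul 0 1 x y

theorem rightAct_F_mul (x y : OSU q) : rightAct (F q) (x * y) =
    rightAct (F q) x * rightAct (K q) y + rightAct (Kinv q) x * rightAct (F q) y := by
  refine slice_mul (fun x y => ?_) x y
  rw [pairing_F, pairing_K, pairing_Kinv]
  exact Fun.skew_mul 1 0 x y

theorem slice_gen (f : OSU q →ₗ[ℂ] ℂ) (g : SUGen) : slice f (gen q g) =
    match g with
      | .a => f (gen q .a) • gen q .a + f (gen q .b) • gen q .c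
      | .b => f (gen q .a) • gen q .b + f (gen q .b) • gen q .d
      | .c => f (gen q .c) • gen q .a + f (gen q .d) • gen q .c
      | .d => f (gen q .c) • gen q .b + f (gen q .d) • gen q .d := by
  cases g <;> simp [slice, comulGen]

theorem rightAct_K_gen (g : SUGen) : rightAct (K q) (gen q g) =
    match g with
      | .a => q.root⁻¹ • gen q .a
      | .b => q.root⁻¹ • gen q .b
      | .c => q.root • gen q .c
      | .d => q.root • gen q .d := by
  have h : ∀ g, pairing (K q) (gen q g) = Fun.torusGen q.root g := fun g => by
    rw [pairing_K]; exact Fun.K_gen g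
  rw [rightAct_eq_slice, slice_gen]
  cases g <;> simp [h, Fun.torusGen]

theorem rightAct_Kinv_gen (g : SUGen) : rightAct (Kinv q) (gen q g) =
    match g with
      | .a => q.root • gen q .a
      | .b => q.root • gen q .b
      | .c => q.root⁻¹ • gen q .c
      | .d => q.root⁻¹ • gen q .d := by
  have h : ∀ g, pairing (Kinv q) (gen q g) = Fun.torusGen q.root⁻¹ g := fun g => by
    rw [pairing_Kinv]; exact Fun.Kinv_gen g
  rw [rightAct_eq_slice, slice_gen]
  cases g <;> simp [h, Fun.torusGen]

theorem rightAct_E_gen (g : SUGen) : rightAct (E q) (gen q g) =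
    match g with
      | .a => 0
      | .b => 0
      | .c => gen q .a
      | .d => gen q .b := by
  have h : ∀ g, pairing (E q) (gen q g) = Fun.skewGen q 0 1 g 0 1 := fun g => by
    rw [pairing_E]; exact Fun.skew_gen 0 1 g
  rw [rightAct_eq_slice, slice_gen]
  cases g <;> simp [h, Fun.skewGen]

theorem rightAct_F_gen (g : SUGen) : rightAct (F q) (gen q g) =
    match g with
      | .a => gen q .c
      | .b => gen q .d
      | .c => 0
      | .d => 0 := by
  have h : ∀ g, pairing (F q) (gen q g) = Fun.skewGen q 1 0 g 0 1 := fun g => by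
    rw [pairing_F]; exact Fun.skew_gen 1 0 g
  rw [rightAct_eq_slice, slice_gen]
  cases g <;> simp [h, Fun.skewGen]

theorem rightAct_K_one : rightAct (K q) (1 : OSU q) = 1 := by
  have h : pairing (K q) 1 = 1 := by rw [pairing_K]; exact Fun.K_one
  simp [rightAct_eq_slice, slice, Algebra.TensorProduct.one_def, h]

theorem rightAct_Kinv_one : rightAct (Kinv q) (1 : OSU q) = 1 := by
  have h : pairing (Kinv q) 1 = 1 := by rw [pairing_Kinv]; exact Fun.Kinv_one
  simp [rightAct_eq_slice, slice, Algebra.TensorProduct.one_def, h]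

theorem rightAct_E_one : rightAct (E q) (1 : OSU q) = 0 := by
  have h : pairing (E q) 1 = 0 := by rw [pairing_E]; exact Fun.skew_one 0 1
  simp [rightAct_eq_slice, slice, Algebra.TensorProduct.one_def, h]

theorem rightAct_K_pow (x : OSU q) (n : ℕ) : rightAct (K q) (x ^ n) = rightAct (K q) x ^ n := by
  induction n with
  | zero => simpa using rightAct_K_one
  | succ n ih => rw [pow_succ, rightAct_K_mul, ih, pow_succ]

theorem rightAct_Kinv_pow (x : OSU q) (n : ℕ) :
    rightAct (Kinv q) (x ^ n) = rightAct (Kinv q) x ^ n := by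
  induction n with
  | zero => simpa using rightAct_Kinv_one
  | succ n ih => rw [pow_succ, rightAct_Kinv_mul, ih, pow_succ]

/-! ### The right action on monomials -/

theorem rightAct_K_bc_mul_a_pow (i j k : ℕ) : rightAct (K q) (bc q j k * gen q .a ^ i) =
    (q.root⁻¹ ^ j * q.root ^ k * q.root⁻¹ ^ i) • (bc q j k * gen q .a ^ i) := by
  simp only [bc, rightAct_K_mul, rightAct_K_pow, rightAct_K_gen, smul_pow, smul_mul_assoc,
    mul_smul_comm, smul_smul]
  ring_nf

theorem rightAct_K_bc_mul_d_pow (i j k : ℕ) : rightAct (K q) (bc q j k * gen q .d ^ i) =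
    (q.root⁻¹ ^ j * q.root ^ k * q.root ^ i) • (bc q j k * gen q .d ^ i) := by
  simp only [bc, rightAct_K_mul, rightAct_K_pow, rightAct_K_gen, smul_pow, smul_mul_assoc,
    mul_smul_comm, smul_smul]
  ring_nf

theorem rightAct_E_pow_eq_zero {x : OSU q} (hx : rightAct (E q) x = 0) (n : ℕ) :
    rightAct (E q) (x ^ n) = 0 := by
  induction n with
  | zero => simpa using rightAct_E_one
  | succ n ih => rw [pow_succ, rightAct_E_mul, ih, hx, zero_mul, mul_zero, add_zero]

theorem rightAct_E_c_pow (k : ℕ) : rightAct (E q) (gen q .c ^ (k + 1)) =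
    qint q.root (k + 1) • (gen q .c ^ k * gen q .a) := by
  induction k with
  | zero => simp [rightAct_E_gen, qint]
  | succ k ih =>
    rw [pow_succ _ (k + 1), rightAct_E_mul, ih, rightAct_Kinv_pow, rightAct_Kinv_gen,
      rightAct_K_gen, rightAct_E_gen, qint_succ q.root (k + 1)]
    simp only [smul_mul_assoc, mul_smul_comm, mul_assoc, ac, smul_pow, q.toC_eq]
    rw [← mul_assoc _ (gen q .c), ← pow_succ]
    module

theorem rightAct_E_d_pow (k : ℕ) : rightAct (E q) (gen q .d ^ (k + 1)) =
    qint q.root⁻¹ (k + 1) • (gen q .b * gen q .d ^ k) := by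
  induction k with
  | zero => simp [rightAct_E_gen, qint]
  | succ k ih =>
    rw [pow_succ' _ (k + 1), rightAct_E_mul, ih, rightAct_K_pow, rightAct_Kinv_gen,
      rightAct_K_gen, rightAct_E_gen, qint_succ q.root⁻¹ (k + 1), inv_inv]
    simp only [smul_mul_assoc, mul_smul_comm, smul_pow]
    rw [← mul_assoc (gen q .d), db, smul_mul_assoc, mul_assoc, ← pow_succ', q.toC_eq, mul_inv]
    module

theorem rightAct_E_bc_zero (j : ℕ) : rightAct (E q) (bc q j 0) = 0 := by
  rw [bc, pow_zero, mul_one, rightAct_E_pow_eq_zero (rightAct_E_gen .b)]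

theorem rightAct_E_bc_succ (j k : ℕ) : rightAct (E q) (bc q j (k + 1)) =
    (q.root ^ j * qint q.root (k + 1)) • (bc q j k * gen q .a) := by
  rw [bc, rightAct_E_mul, rightAct_E_pow_eq_zero (rightAct_E_gen .b), rightAct_E_c_pow,
    rightAct_Kinv_pow, rightAct_Kinv_gen, zero_mul, zero_add]
  simp only [smul_pow, smul_mul_assoc, mul_smul_comm, bc, mul_assoc]
  module

theorem rightAct_E_bc_zero_mul_a_pow (i j : ℕ) :
    rightAct (E q) (bc q j 0 * gen q .a ^ i) = 0 := by
  rw [rightAct_E_mul, rightAct_E_bc_zero, rightAct_E_pow_eq_zero (rightAct_E_gen .a), zero_mul,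
    mul_zero, add_zero]

theorem rightAct_E_bc_succ_mul_a_pow (i j k : ℕ) :
    rightAct (E q) (bc q j (k + 1) * gen q .a ^ i) =
      (q.root ^ j * qint q.root (k + 1) * q.root⁻¹ ^ i) • (bc q j k * gen q .a ^ (i + 1)) := by
  rw [rightAct_E_mul, rightAct_E_bc_succ, rightAct_E_pow_eq_zero (rightAct_E_gen .a),
    rightAct_K_pow, rightAct_K_gen, mul_zero, add_zero]
  simp only [smul_pow, smul_mul_assoc, mul_smul_comm, mul_assoc _ (gen q .a), ← pow_succ']
  module

theorem rightAct_E_bc_zero_mul_d_pow (i j : ℕ) :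
    rightAct (E q) (bc q j 0 * gen q .d ^ (i + 1)) =
      (q.root ^ j * qint q.root⁻¹ (i + 1)) • (bc q (j + 1) 0 * gen q .d ^ i) := by
  rw [rightAct_E_mul, rightAct_E_bc_zero, rightAct_E_d_pow, zero_mul, zero_add, bc,
    rightAct_Kinv_mul, rightAct_Kinv_pow, rightAct_Kinv_gen]
  simp only [smul_pow, smul_mul_assoc, mul_smul_comm, smul_smul, bc, pow_zero, rightAct_Kinv_one,
    mul_one, ← mul_assoc, ← pow_succ, mul_comm (qint _ _)]

theorem rightAct_E_bc_succ_mul_d_pow (i j k : ℕ) :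
    rightAct (E q) (bc q j (k + 1) * gen q .d ^ (i + 1)) =
      (q.root ^ j * qint q.root (k + 1) * q.root ^ (i + 1)) • (bc q j k * gen q .d ^ i) +
      (q.root ^ j * (qint q.root (k + 1) * q.root ^ (i + 3) +
        q.root⁻¹ ^ (k + 1) * qint q.root⁻¹ (i + 1))) • (bc q (j + 1) (k + 1) * gen q .d ^ i) := by
  have h : rightAct (Kinv q) (bc q j (k + 1)) =
      (q.root ^ j * q.root⁻¹ ^ (k + 1)) • bc q j (k + 1) := by
    simp only [bc, rightAct_Kinv_mul, rightAct_Kinv_pow, rightAct_Kinv_gen, smul_pow,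
      smul_mul_assoc, mul_smul_comm, smul_smul]
    ring_nf
  rw [rightAct_E_mul, rightAct_E_bc_succ, rightAct_E_d_pow, rightAct_K_pow, rightAct_K_gen, h]
  simp only [smul_pow, smul_mul_assoc, mul_smul_comm, smul_smul]
  rw [← mul_assoc (bc q _ _) (gen q .b), bc_mul_b, pow_succ' (gen q .d), mul_assoc (bc q _ _),
    ← mul_assoc (gen q .a), ← mul_assoc (bc q _ _), bc_mul_ad, add_mul, smul_mul_assoc, q.toC_eq]
  module

/-! ### The Haar state -/

theorem haar_rightAct_K (x : OSU q) : haar q (rightAct (K q) x) = haar q x := by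
  have h : haar q ∘ₗ rightAct (K q) = haar q := by
    have h0 : ∀ j k, (q.root⁻¹ ^ j * q.root ^ k) * haar q (bc q j k) = haar q (bc q j k) := by
      intro j k
      rw [haar_bc]
      split_ifs with hjk
      · rw [hjk, ← mul_pow, inv_mul_cancel₀ q.root_ne_zero, one_pow, one_mul]
      · rw [mul_zero]
    refine linearMap_ext_monomials (fun i j k => ?_) (fun i j k => ?_)
    · rw [LinearMap.comp_apply, rightAct_K_bc_mul_a_pow, map_smul]
      cases i with
      | zero => simpa using h0 j k
      | succ i => rw [haar_bc_mul_a_pow, smul_zero]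
    · rw [LinearMap.comp_apply, rightAct_K_bc_mul_d_pow, map_smul]
      cases i with
      | zero => simpa using h0 j k
      | succ i => rw [haar_bc_mul_d_pow, smul_zero]
  exact LinearMap.congr_fun h x

/-- On `b ^ j c ^ (j + 1) d` this is the recursion `qint_mul_moment` for the moments; on all other
monomials `E` produces only monomials on which `haar q` vanishes. -/
theorem haar_rightAct_E (x : OSU q) : haar q (rightAct (E q) x) = 0 := by
  have h : haar q ∘ₗ rightAct (E q) = 0 := by
    refine linearMap_ext_monomials (fun i j k => ?_) (fun i j k => ?_)
    · rw [LinearMap.comp_apply, LinearMap.zero_apply]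
      cases k with
      | zero => rw [rightAct_E_bc_zero_mul_a_pow, map_zero]
      | succ k => rw [rightAct_E_bc_succ_mul_a_pow, map_smul, haar_bc_mul_a_pow, smul_zero]
    · rw [LinearMap.comp_apply, LinearMap.zero_apply]
      rcases i with _ | _ | i
      · rw [pow_zero, mul_one]
        cases k with
        | zero => rw [rightAct_E_bc_zero, map_zero]
        | succ k =>
          have := haar_bc_mul_a_pow (q := q) j k 0
          rw [zero_add, pow_one] at this
          rw [rightAct_E_bc_succ, map_smul, this, smul_zero]
      · cases k with
        | zero => rw [rightAct_E_bc_zero_mul_d_pow, pow_zero, mul_one, map_smul, haar_bc,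
            if_neg (Nat.succ_ne_zero j), smul_zero]
        | succ k =>
          rw [rightAct_E_bc_succ_mul_d_pow, pow_zero, mul_one, mul_one, map_add, map_smul,
            map_smul, haar_bc, haar_bc]
          by_cases hjk : j = k
          · subst hjk
            have h1 := qint_mul_moment q j
            have h3 : qint q.root⁻¹ (0 + 1) = 1 := by simp [qint]
            rw [qint_succ q.root (j + 1)] at h1
            rw [if_pos rfl, if_pos rfl, h3, smul_eq_mul, smul_eq_mul]
            linear_combination q.root ^ j * h1
          · simp [hjk]
      · cases k with
        | zero => rw [rightAct_E_bc_zero_mul_d_pow, map_smul, haar_bc_mul_d_pow, smul_zero]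
        | succ k =>
          rw [rightAct_E_bc_succ_mul_d_pow, map_add, map_smul, map_smul, haar_bc_mul_d_pow,
            haar_bc_mul_d_pow, smul_zero, smul_zero, add_zero]
  exact LinearMap.congr_fun h x

theorem slice_haar_rightAct (f : Uq q) (r : ℂ)
    (hf : ∀ x, haar q (rightAct f x) = r * haar q x) (x : OSU q) :
    slice (haar q) (rightAct f x) = r • slice (haar q) x := by
  have h : (toConv (pairing f) * toConv (haar q) : Fun q).ofConv = r • haar q := by
    ext x
    exact (conv_apply_eq_apply_slice _ _ x).trans (hf x)
  rw [rightAct_eq_slice, slice_slice, h]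
  simp [slice]

/-- The functional `haar q` is invariant on one side. Its slice map kills the image of `E` and
satisfies `slice (x ◁ K) = slice x`, while modulo these images every monomial is a scalar. -/
theorem slice_haar (x : OSU q) : slice (haar q) x = haar q x • 1 := by
  set N : Submodule ℂ (OSU q) :=
    LinearMap.eqLocus (slice (haar q)) ((haar q).smulRight (1 : OSU q)) with hN
  have hE : ∀ x, rightAct (E q) x ∈ N := fun x => by
    change slice (haar q) _ = haar q _ • 1
    rw [slice_haar_rightAct _ 0 (by simp [haar_rightAct_E]), haar_rightAct_E, zero_smul, zero_smul]
  have hK : ∀ (x : OSU q) (r : ℂ), rightAct (K q) x = r • x → r ≠ 1 → x ∈ N := by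
    intro x r hx hr
    have h1 : slice (haar q) (rightAct (K q) x) = (1 : ℂ) • slice (haar q) x :=
      slice_haar_rightAct _ _ (by simp [haar_rightAct_K]) x
    have h2 := haar_rightAct_K x
    rw [hx, map_smul] at h1 h2
    have h3 : (r - 1) • slice (haar q) x = 0 := by rw [sub_smul, h1, sub_self]
    have h4 : (r - 1) * haar q x = 0 := by
      rw [sub_mul, one_mul, sub_eq_zero]; exact h2
    have hr' := sub_ne_zero.mpr hr
    change slice (haar q) x = haar q x • 1
    rw [(smul_eq_zero.mp h3).resolve_left hr', (mul_eq_zero.mp h4).resolve_left hr', zero_smul]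
  have h1 : (1 : OSU q) ∈ N := by
    change slice (haar q) 1 = haar q 1 • 1
    simp [slice, Algebra.TensorProduct.one_def]
  -- For `j = 0` the monomial is a scalar or has nontrivial `K`-weight. For `j > 0` it appears in
  -- the image under `E` of `b ^ (j - 1) c ^ k d ^ (i + 1)`, next to a monomial with smaller `k`.
  have hd : ∀ k i j, bc q j k * gen q .d ^ i ∈ N := by
    have hroot : ∀ n : ℕ, q.root ^ (n + 1) ≠ 1 := by
      intro n h
      rw [Param.root, ← Complex.ofReal_pow, Complex.ofReal_eq_one] at h
      exact (pow_lt_one₀ (Real.sqrt_nonneg _)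
        (by rw [Real.sqrt_lt' one_pos, one_pow]; exact q.2.2) (Nat.succ_ne_zero n)).ne h
    have hj0 : ∀ k i, bc q 0 k * gen q .d ^ i ∈ N := by
      intro k i
      rcases h : k + i with _ | n
      · obtain ⟨rfl, rfl⟩ : k = 0 ∧ i = 0 := by omega
        simpa [bc] using h1
      · refine hK _ _ (rightAct_K_bc_mul_d_pow i 0 k) ?_
        rw [pow_zero, one_mul, ← pow_add, h]
        exact hroot n
    have hs : 0 < Real.sqrt q := Real.sqrt_pos.mpr q.2.1
    have hs' : 0 < (Real.sqrt q)⁻¹ := inv_pos.mpr hs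
    have hroot' : q.root⁻¹ = (((Real.sqrt q)⁻¹ : ℝ) : ℂ) := by rw [Param.root, Complex.ofReal_inv]
    intro k
    induction k with
    | zero =>
      intro i j
      cases j with
      | zero => exact hj0 _ _
      | succ j =>
        have h := hE (bc q j 0 * gen q .d ^ (i + 1))
        rw [rightAct_E_bc_zero_mul_d_pow] at h
        refine (Submodule.smul_mem_iff _ ?_).mp h
        obtain ⟨r, hr, hr'⟩ := qint_pos hs' i
        rw [hroot', hr']
        exact mul_ne_zero (pow_ne_zero _ q.root_ne_zero) (Complex.ofReal_ne_zero.mpr hr.ne')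
    | succ k ih =>
      intro i j
      cases j with
      | zero => exact hj0 _ _
      | succ j =>
        have h := hE (bc q j (k + 1) * gen q .d ^ (i + 1))
        rw [rightAct_E_bc_succ_mul_d_pow] at h
        have h := (Submodule.add_mem_iff_right _ (N.smul_mem _ (ih i j))).mp h
        refine (Submodule.smul_mem_iff _ ?_).mp h
        obtain ⟨r, hr, hr'⟩ := qint_pos hs' i
        obtain ⟨t, ht, ht'⟩ := qint_pos hs k
        refine mul_ne_zero (pow_ne_zero _ q.root_ne_zero) ?_
        rw [hroot', hr', Param.root, ht', ← Complex.ofReal_pow, ← Complex.ofReal_pow,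
          ← Complex.ofReal_mul, ← Complex.ofReal_mul, ← Complex.ofReal_add]
        exact Complex.ofReal_ne_zero.mpr (by positivity)
  refine mem_of_monomials (S := N) (fun i j k => ?_) (fun i j k => hd k i j) x
  cases i with
  | zero => simpa using hd k 0 j
  | succ i =>
    have h := hE (bc q j (k + 1) * gen q .a ^ i)
    rw [rightAct_E_bc_succ_mul_a_pow] at h
    refine (Submodule.smul_mem_iff _ ?_).mp h
    exact mul_ne_zero (mul_ne_zero (pow_ne_zero _ q.root_ne_zero) (q.qint_ne_zero k))
      (pow_ne_zero _ (inv_ne_zero q.root_ne_zero))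

/-- The images of the generators under `transpose`. -/
def transposeGen : SUGen → SUGen
  | .a => .a
  | .b => .c
  | .c => .b
  | .d => .d

/-- The algebra automorphism of `O(SU_q(2))` that exchanges `b` and `c`; it reverses the
comultiplication. -/
noncomputable def transpose (q : Param) : OSU q →ₐ[ℂ] OSU q :=
  lift (fun g => gen q (transposeGen g)) (by
    intro s t h
    cases h <;> simp [transposeGen, ab, ac, ad, da, cb, smul_smul, db, dc, q.toC_ne_zero])

theorem transpose_gen (g : SUGen) : transpose q (gen q g) = gen q (transposeGen g) :=
  lift_gen _ _ g

theorem transpose_transpose (x : OSU q) : transpose q (transpose q x) = x := by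
  have h : (transpose q).comp (transpose q) = AlgHom.id ℂ (OSU q) := by
    refine hom_ext fun g => ?_
    cases g <;> simp [transpose_gen, transposeGen]
  exact DFunLike.congr_fun h x

theorem comul_transpose (x : OSU q) : Coalgebra.comul (R := ℂ) (transpose q x) =
    TensorProduct.comm ℂ _ _ (TensorProduct.map (transpose q).toLinearMap
      (transpose q).toLinearMap (Coalgebra.comul (R := ℂ) x)) := by
  have h : (Bialgebra.comulAlgHom ℂ (OSU q)).comp (transpose q) =
      (Algebra.TensorProduct.comm ℂ (OSU q) (OSU q)).toAlgHom.comp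
        ((Algebra.TensorProduct.map (transpose q) (transpose q)).comp
          (Bialgebra.comulAlgHom ℂ (OSU q))) := by
    refine hom_ext fun g => ?_
    cases g <;> simp [transpose_gen, transposeGen, comulGen]
  exact DFunLike.congr_fun h x

theorem slice_transpose (f : OSU q →ₗ[ℂ] ℂ) (x : OSU q) :
    slice f (transpose q x) = transpose q (coslice (f ∘ₗ (transpose q).toLinearMap) x) := by
  simp only [slice, coslice, LinearMap.comp_apply, comul_transpose]
  generalize Coalgebra.comul (R := ℂ) x = X
  induction X with
  | zero => simp
  | add X Y hX hY => simp only [map_add, hX, hY]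
  | tmul x y => simp

/-- A left invariant and a right invariant normalized functional coincide: both equal their
convolution product. -/
theorem eq_of_invariant {f g : OSU q →ₗ[ℂ] ℂ} (hf1 : f 1 = 1) (hg1 : g 1 = 1)
    (hf : ∀ x, slice f x = f x • 1) (hg : ∀ x, coslice g x = g x • 1) : f = g := by
  ext x
  have h := (conv_apply_eq_apply_slice f g x).symm.trans (conv_apply_eq_apply_coslice f g x)
  rw [hf, hg, map_smul, map_smul, hf1, hg1, smul_eq_mul, smul_eq_mul, mul_one, mul_one] at h
  exact h

theorem coslice_haar_transpose (x : OSU q) : coslice (haar q ∘ₗ (transpose q).toLinearMap) x =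
    (haar q ∘ₗ (transpose q).toLinearMap) x • 1 := by
  have h := congrArg (transpose q) (slice_transpose (haar q) x)
  rw [transpose_transpose, slice_haar, map_smul, map_one] at h
  exact h.symm

theorem haar_comp_transpose : haar q ∘ₗ (transpose q).toLinearMap = haar q :=
  (eq_of_invariant haar_one (by simp [haar_one]) slice_haar coslice_haar_transpose).symm

theorem coslice_haar (x : OSU q) : coslice (haar q) x = haar q x • 1 := by
  have h := coslice_haar_transpose x
  rwa [haar_comp_transpose] at h

theorem isHaarState_haar (q : Param) : IsHaarState (haar q) :=
  ⟨haar_one, coslice_haar, slice_haar⟩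

theorem IsHaarState.eq_haar {h : OSU q →ₗ[ℂ] ℂ} (hh : IsHaarState h) : h = haar q :=
  eq_of_invariant hh.1 haar_one hh.2.2 coslice_haar

/-- The Haar state is invariant under the right action of `U_q(su₂)`. -/
theorem haar_rightAct (f : Uq q) (x : OSU q) :
    haar q (rightAct f x) = pairing f 1 * haar q x := by
  rw [rightAct_eq_slice, ← conv_apply_eq_apply_slice, conv_apply_eq_apply_coslice, coslice_haar,
    map_smul, smul_eq_mul, mul_comm]

/-! ### The modular property of the Haar state -/

theorem haar_mul_b (y : OSU q) : haar q (y * gen q .b) = haar q (gen q .b * y) := by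
  have h : haar q ∘ₗ LinearMap.mulRight ℂ (gen q .b) = haar q ∘ₗ LinearMap.mulLeft ℂ (gen q .b) := by
    refine linearMap_ext_monomials (fun i j k => ?_) (fun i j k => ?_)
    all_goals
      simp only [LinearMap.comp_apply, LinearMap.mulRight_apply, LinearMap.mulLeft_apply]
      rw [← mul_assoc, b_mul_bc]
      cases i with
      | zero => rw [pow_zero, mul_one, mul_one, bc_mul_b]
      | succ i => ?_
    · have hc : gen q .b * gen q .a = q.toC⁻¹ • (gen q .a * gen q .b) := ba
      have hp : gen q .a ^ (i + 1) * gen q .b = q.toC ^ (i + 1) • (gen q .b * gen q .a ^ (i + 1)) := by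
        rw [mul_pow_of_mul_eq_smul hc, smul_smul, ← mul_pow, mul_inv_cancel₀ q.toC_ne_zero, one_pow,
          one_smul]
      rw [mul_assoc, hp, mul_smul_comm, ← mul_assoc, bc_mul_b, map_smul, haar_bc_mul_a_pow,
        smul_zero]
    · have hc : gen q .b * gen q .d = q.toC • (gen q .d * gen q .b) := by
        rw [db, smul_inv_smul₀ q.toC_ne_zero]
      have hp : gen q .d ^ (i + 1) * gen q .b =
          q.toC⁻¹ ^ (i + 1) • (gen q .b * gen q .d ^ (i + 1)) := by
        rw [mul_pow_of_mul_eq_smul hc, smul_smul, ← mul_pow, inv_mul_cancel₀ q.toC_ne_zero, one_pow,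
          one_smul]
      rw [mul_assoc, hp, mul_smul_comm, ← mul_assoc, bc_mul_b, map_smul, haar_bc_mul_d_pow,
        smul_zero]
  exact LinearMap.congr_fun h y

theorem haar_transpose (x : OSU q) : haar q (transpose q x) = haar q x :=
  LinearMap.congr_fun haar_comp_transpose x

theorem haar_mul_c (y : OSU q) : haar q (y * gen q .c) = haar q (gen q .c * y) := by
  have h := haar_mul_b (transpose q y)
  have hb : gen q .b = transpose q (gen q .c) := by rw [transpose_gen]; rfl
  rwa [hb, ← map_mul, ← map_mul, haar_transpose, haar_transpose] at h

theorem haar_mul_bc (y : OSU q) : haar q (y * (gen q .b * gen q .c)) =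
    haar q (gen q .b * (gen q .c * y)) := by
  rw [← mul_assoc, haar_mul_c, ← mul_assoc, haar_mul_b]

/-- The identity between moments behind `haar_mul_a`: both recursions for `qint` enter. -/
theorem moment_modular (k : ℕ) : moment q k + q.toC⁻¹ * moment q (k + 1) =
    q.toC ^ (2 * k + 2) * (moment q k + q.toC * moment q (k + 1)) := by
  have h0 := q.root_ne_zero
  have h2 := q.qint_ne_zero (k + 1)
  have e1 := qint_succ q.root (k + 1)
  have e2 := qint_succ' q.root (k + 1)
  have hm := qint_mul_moment q k
  have e3 : q.root * q.root⁻¹ = 1 := mul_inv_cancel₀ h0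
  have e4 : q.root ^ (k + 1) * q.root⁻¹ ^ (k + 1) = 1 := by rw [← mul_pow, e3, one_pow]
  apply mul_left_cancel₀ h2
  have hl : qint q.root (k + 2) * (moment q k + q.toC⁻¹ * moment q (k + 1)) =
      q.root ^ (3 * (k + 1)) * moment q k := by
    rw [mul_add, mul_left_comm, hm, e2, q.toC_eq]
    field_simp
    ring
  have hr : qint q.root (k + 2) * (moment q k + q.toC * moment q (k + 1)) =
      q.root⁻¹ ^ (k + 1) * moment q k := by
    rw [mul_add, mul_left_comm, hm, e1, q.toC_eq]
    ring
  rw [hl, mul_left_comm, hr, q.toC_eq]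
  linear_combination (-q.root ^ (3 * (k + 1)) * moment q k) * e4

theorem haar_mul_a (y : OSU q) : haar q (y * gen q .a) = q.toC ^ 2 * haar q (gen q .a * y) := by
  have h : haar q ∘ₗ LinearMap.mulRight ℂ (gen q .a) =
      q.toC ^ 2 • (haar q ∘ₗ LinearMap.mulLeft ℂ (gen q .a)) := by
    refine linearMap_ext_monomials (fun i j k => ?_) (fun i j k => ?_)
    all_goals
      simp only [LinearMap.comp_apply, LinearMap.mulRight_apply, LinearMap.mulLeft_apply,
        LinearMap.smul_apply]
      rw [← mul_assoc, a_mul_bc, smul_mul_assoc, mul_assoc, mul_assoc]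
    · rw [← pow_succ, ← pow_succ', map_smul, haar_bc_mul_a_pow, smul_zero, smul_zero]
    · rcases i with _ | _ | i
      · have := haar_bc_mul_a_pow (q := q) j k 0
        rw [zero_add, pow_one] at this
        rw [pow_zero, one_mul, mul_one, map_smul, this, smul_zero, smul_zero]
      · rw [zero_add, pow_one, bc_mul_ad, bc_mul_da]
        simp only [map_smul, map_add, haar_bc, smul_eq_mul]
        by_cases hjk : j = k
        · subst hjk
          rw [if_pos rfl, if_pos rfl, moment_modular]
          ring
        · simp [hjk]
      · rw [pow_succ _ (i + 1), mul_assoc, ← mul_assoc (bc q j k) _ (gen q .d * gen q .a), da,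
          ← pow_succ, pow_succ' _ (i + 1), ← mul_assoc (gen q .a), ← mul_assoc (bc q j k), bc_mul_ad,
          mul_add, mul_one, mul_smul_comm, add_mul, smul_mul_assoc]
        simp only [map_smul, map_add, haar_mul_bc, haar_bc_mul_d_pow, smul_zero, add_zero]
        rw [← mul_assoc (gen q .c), c_mul_bc, ← mul_assoc, b_mul_bc, haar_bc_mul_d_pow, smul_zero,
          zero_add]
  exact LinearMap.congr_fun h y

theorem haar_mul_d (y : OSU q) : haar q (y * gen q .d) = q.toC⁻¹ ^ 2 * haar q (gen q .d * y) := by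
  have h0 := q.toC_ne_zero
  have h : haar q ∘ₗ LinearMap.mulRight ℂ (gen q .d) =
      q.toC⁻¹ ^ 2 • (haar q ∘ₗ LinearMap.mulLeft ℂ (gen q .d)) := by
    have hd : ∀ i j k, haar q (bc q j k * gen q .d ^ i * gen q .d) =
        q.toC⁻¹ ^ 2 * haar q (gen q .d * (bc q j k * gen q .d ^ i)) := by
      intro i j k
      rw [← mul_assoc, d_mul_bc, smul_mul_assoc, mul_assoc, mul_assoc, ← pow_succ, ← pow_succ',
        map_smul, haar_bc_mul_d_pow, smul_zero, mul_zero]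
    refine linearMap_ext_monomials (fun i j k => ?_) (fun i j k => hd i j k)
    cases i with
    | zero => simpa using hd 0 j k
    | succ i =>
      -- The monomial is a multiple of `a * x`, and `h(axd) = q⁻² h(xda) = q⁻² h(dax)`, because
      -- `b` and `c`, and hence `da = 1 + q⁻¹ bc`, can be moved around under `h`.
      have hm : bc q j k * gen q .a ^ (i + 1) =
          (q.toC ^ (j + k))⁻¹ • (gen q .a * (bc q j k * gen q .a ^ i)) := by
        rw [← mul_assoc, a_mul_bc, smul_mul_assoc, inv_smul_smul₀ (pow_ne_zero _ h0), mul_assoc,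
          ← pow_succ']
      generalize bc q j k * gen q .a ^ i = x at hm
      have hx : haar q (gen q .a * x * gen q .d) =
          q.toC⁻¹ ^ 2 * haar q (gen q .d * (gen q .a * x)) := by
        have h1 := haar_mul_a (x * gen q .d)
        have h2 : haar q (x * gen q .d * gen q .a) = haar q (gen q .d * (gen q .a * x)) := by
          rw [mul_assoc, ← mul_assoc (gen q .d), da, mul_add, add_mul, mul_one, one_mul,
            mul_smul_comm, smul_mul_assoc, map_add, map_add, map_smul, map_smul, haar_mul_bc,
            mul_assoc]
        rw [← h2, h1, mul_assoc]
        field_simp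
      simp only [LinearMap.comp_apply, LinearMap.mulRight_apply, LinearMap.mulLeft_apply,
        LinearMap.smul_apply, smul_eq_mul]
      rw [hm, smul_mul_assoc, mul_smul_comm, map_smul, map_smul, hx, smul_eq_mul, smul_eq_mul,
        mul_left_comm]
  exact LinearMap.congr_fun h y

theorem sigma_coe (x : podles q) : (sigma q x : OSU q) =
    Uq.charAct q q.toC⁻¹ (inv_ne_zero q.toC_ne_zero) x :=
  leftAct_Kinv_sq q x

/-- The modular property: on the Podleś sphere `σ` is the modular automorphism of the Haar state. -/
theorem haar_mul_podles (y : OSU q) (x : podles q) :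
    haar q (y * x) = haar q ((sigma q x : OSU q) * y) := by
  have h0 := q.toC_ne_zero
  rw [sigma_coe]
  obtain ⟨x, hx⟩ := x
  change haar q (y * x) = haar q (Uq.charAct q q.toC⁻¹ (inv_ne_zero q.toC_ne_zero) x * y)
  induction hx using Algebra.adjoin_induction generalizing y with
  | mem x hx =>
    rcases hx with rfl | rfl | rfl
    · have h : Uq.charAct q q.toC⁻¹ (inv_ne_zero q.toC_ne_zero) (genA q) = genA q := by
        simp [genA, Uq.charAct_gen, smul_smul, h0]
      rw [h, genA, mul_smul_comm, smul_mul_assoc, map_smul, map_smul, haar_mul_bc, mul_assoc]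
    · have h : Uq.charAct q q.toC⁻¹ (inv_ne_zero q.toC_ne_zero) (genB q) = q.toC ^ 2 • genB q := by
        simp [genB, Uq.charAct_gen, smul_smul, pow_two]
      rw [h, genB, smul_mul_assoc, map_smul, ← mul_assoc, haar_mul_c, ← mul_assoc, haar_mul_a,
        smul_eq_mul, mul_assoc]
    · have h : Uq.charAct q q.toC⁻¹ (inv_ne_zero q.toC_ne_zero) (genBstar q) =
          q.toC⁻¹ ^ 2 • genBstar q := by
        simp [genBstar, Uq.charAct_gen, smul_smul, pow_two]
      rw [h, genBstar, smul_mul_assoc, map_smul, mul_neg, neg_mul, map_neg, map_neg, ← mul_assoc,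
        haar_mul_b, ← mul_assoc, haar_mul_d, smul_eq_mul, mul_assoc, mul_neg]
  | algebraMap r => rw [AlgHom.commutes, Algebra.commutes]
  | add x x' _ _ hx hx' => rw [mul_add, map_add, hx, hx', map_add, add_mul, map_add]
  | mul x x' _ _ hx hx' => rw [← mul_assoc, hx', ← mul_assoc, hx, map_mul (Uq.charAct q _ _), mul_assoc]

/-! ### The derivations of the Podleś sphere -/

theorem rightAct_K_podles (x : podles q) : rightAct (K q) (x : OSU q) = x := by
  have h0 := q.root_ne_zero
  obtain ⟨x, hx⟩ := x
  change rightAct (K q) x = x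
  induction hx using Algebra.adjoin_induction with
  | mem x hx =>
    rcases hx with rfl | rfl | rfl <;>
      simp [genA, genB, genBstar, rightAct_K_mul, rightAct_K_gen, smul_smul, h0]
  | algebraMap r => rw [Algebra.algebraMap_eq_smul_one, map_smul, rightAct_K_one]
  | add x x' _ _ hx hx' => rw [map_add, hx, hx']
  | mul x x' _ _ hx hx' => rw [rightAct_K_mul, hx, hx']

theorem rightAct_Kinv_podles (x : podles q) : rightAct (Kinv q) (x : OSU q) = x := by
  conv_lhs => rw [← rightAct_K_podles x, rightAct_rightAct, Uq.K_mul_Kinv, rightAct_one]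

theorem rightAct_K_E_podles (x : podles q) :
    rightAct (K q) (rightAct (E q) (x : OSU q)) = q.toC⁻¹ • rightAct (E q) (x : OSU q) := by
  have h : E q * K q = q.toC⁻¹ • (K q * E q) := by
    rw [Uq.K_mul_E, inv_smul_smul₀ q.toC_ne_zero]
  rw [rightAct_rightAct, h, rightAct_smul, ← rightAct_rightAct, rightAct_K_podles]

theorem rightAct_K_F_podles (x : podles q) :
    rightAct (K q) (rightAct (F q) (x : OSU q)) = q.toC • rightAct (F q) (x : OSU q) := by
  rw [rightAct_rightAct, Uq.F_mul_K, rightAct_smul, ← rightAct_rightAct, rightAct_K_podles]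

theorem rightAct_Kinv_E_podles (x : podles q) :
    rightAct (Kinv q) (rightAct (E q) (x : OSU q)) = q.toC • rightAct (E q) (x : OSU q) := by
  rw [rightAct_rightAct, Uq.E_mul_Kinv, rightAct_smul, ← rightAct_rightAct, rightAct_Kinv_podles]

theorem rightAct_Kinv_F_podles (x : podles q) :
    rightAct (Kinv q) (rightAct (F q) (x : OSU q)) = q.toC⁻¹ • rightAct (F q) (x : OSU q) := by
  have h : F q * Kinv q = q.toC⁻¹ • (Kinv q * F q) := by
    rw [Uq.Kinv_mul_F, inv_smul_smul₀ q.toC_ne_zero]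
  rw [rightAct_rightAct, h, rightAct_smul, ← rightAct_rightAct, rightAct_Kinv_podles]

/-- `E` and `F` commute here because `K² - K⁻²` acts by zero. -/
theorem rightAct_F_E_podles (x : podles q) :
    rightAct (F q) (rightAct (E q) (x : OSU q)) = rightAct (E q) (rightAct (F q) (x : OSU q)) := by
  have h := congrArg (fun f => rightAct f (x : OSU q)) (Uq.E_F_comm (q := q))
  simp only [rightAct_sub, rightAct_smul, ← rightAct_rightAct, rightAct_K_podles,
    rightAct_Kinv_podles, sub_self, smul_zero] at h
  exact sub_eq_zero.mp h

theorem rightAct_E_mul_podles (x y : podles q) : rightAct (E q) ((x : OSU q) * y) =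
    rightAct (E q) (x : OSU q) * y + x * rightAct (E q) (y : OSU q) := by
  rw [rightAct_E_mul, rightAct_K_podles, rightAct_Kinv_podles]

theorem rightAct_F_mul_podles (x y : podles q) : rightAct (F q) ((x : OSU q) * y) =
    rightAct (F q) (x : OSU q) * y + x * rightAct (F q) (y : OSU q) := by
  rw [rightAct_F_mul, rightAct_K_podles, rightAct_Kinv_podles]

theorem R_E (x : OSU q) : R (E q) x = -q.toC⁻¹ • rightAct (E q) x := by
  rw [Uq.R, Uq.antipodeInv_E, rightAct_smul]

theorem R_F (x : OSU q) : R (F q) x = -q.toC • rightAct (F q) x := by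
  rw [Uq.R, Uq.antipodeInv_F, rightAct_smul]

/-- The scalars `-q` and `-q⁻¹` by which `S⁻¹` multiplies `F` and `E` cancel in `τ`. -/
theorem tau_apply (h : OSU q →ₗ[ℂ] ℂ) (x y z : podles q) : tau q h ![x, y, z] =
    h (x * (rightAct (F q) (y : OSU q) * rightAct (E q) (z : OSU q))) -
      q.toC ^ 2 * h (x * (rightAct (E q) (y : OSU q) * rightAct (F q) (z : OSU q))) := by
  have h0 := q.toC_ne_zero
  change h ((x : OSU q) * (R (F q) y * R (E q) z - q.toC ^ 2 • (R (E q) y * R (F q) z))) = _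
  simp only [R_E, R_F, smul_mul_assoc, mul_smul_comm, smul_smul, mul_sub, map_sub, map_smul,
    smul_eq_mul]
  field_simp

/-! ### The twisted cyclic cocycle -/

theorem twistedCoboundary_two {X : Type*} [Ring X] [Algebra ℂ X] (σ : X ≃ₐ[ℂ] X)
    (φ : MultilinearMap ℂ (fun _ : Fin 3 => X) ℂ) (x y z t : X) :
    twistedCoboundary σ φ ![x, y, z, t] =
      φ ![x * y, z, t] - φ ![x, y * z, t] + φ ![x, y, z * t] - φ ![σ t * x, y, z] := by
  have h1 : Fin.contractNth (0 : Fin 4) (· * ·) ![x, y, z, t] = ![x * y, z, t] := by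
    ext i; fin_cases i <;> rfl
  have h2 : Fin.contractNth (1 : Fin 4) (· * ·) ![x, y, z, t] = ![x, y * z, t] := by
    ext i; fin_cases i <;> rfl
  have h3 : Fin.contractNth (2 : Fin 4) (· * ·) ![x, y, z, t] = ![x, y, z * t] := by
    ext i; fin_cases i <;> rfl
  have h4 : (Fin.cons (σ (![x, y, z, t] (Fin.last 3)) * ![x, y, z, t] 0)
      fun i : Fin 2 => ![x, y, z, t] i.succ.castSucc : Fin 3 → X) = ![σ t * x, y, z] := by
    ext i; fin_cases i <;> rfl
  rw [twistedCoboundary, Fin.sum_univ_three, h4]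
  change (-1) ^ 0 * φ (Fin.contractNth (0 : Fin 4) (· * ·) ![x, y, z, t]) +
    (-1) ^ 1 * φ (Fin.contractNth (1 : Fin 4) (· * ·) ![x, y, z, t]) +
    (-1) ^ 2 * φ (Fin.contractNth (2 : Fin 4) (· * ·) ![x, y, z, t]) + _ = _
  rw [h1, h2, h3]
  ring

theorem twistedCoboundary_one {X : Type*} [Ring X] [Algebra ℂ X] (σ : X ≃ₐ[ℂ] X)
    (ψ : MultilinearMap ℂ (fun _ : Fin 2 => X) ℂ) (x y z : X) :
    twistedCoboundary σ ψ ![x, y, z] = ψ ![x * y, z] - ψ ![x, y * z] + ψ ![σ z * x, y] := by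
  have h1 : Fin.contractNth (0 : Fin 3) (· * ·) ![x, y, z] = ![x * y, z] := by
    ext i; fin_cases i <;> rfl
  have h2 : Fin.contractNth (1 : Fin 3) (· * ·) ![x, y, z] = ![x, y * z] := by
    ext i; fin_cases i <;> rfl
  have h3 : (Fin.cons (σ (![x, y, z] (Fin.last 2)) * ![x, y, z] 0)
      fun i : Fin 1 => ![x, y, z] i.succ.castSucc : Fin 2 → X) = ![σ z * x, y] := by
    ext i; fin_cases i <;> rfl
  rw [twistedCoboundary, Fin.sum_univ_two, h3]
  change (-1) ^ 0 * ψ (Fin.contractNth (0 : Fin 3) (· * ·) ![x, y, z]) +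
    (-1) ^ 1 * ψ (Fin.contractNth (1 : Fin 3) (· * ·) ![x, y, z]) + _ = _
  rw [h1, h2]
  ring

theorem vec_four {X : Type*} (x : Fin 4 → X) : x = ![x 0, x 1, x 2, x 3] := by
  ext i; fin_cases i <;> rfl

theorem vec_three {X : Type*} (x : Fin 3 → X) : x = ![x 0, x 1, x 2] := by
  ext i; fin_cases i <;> rfl

theorem twistedCoboundary_tau (x : Fin 4 → podles q) :
    twistedCoboundary (sigma q) (tau q (haar q)) x = 0 := by
  rw [vec_four x, twistedCoboundary_two]
  generalize x 0 = x₀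
  generalize x 1 = x₁
  generalize x 2 = x₂
  generalize x 3 = x₃
  simp only [tau_apply, MulMemClass.coe_mul, rightAct_E_mul_podles, rightAct_F_mul_podles,
    mul_assoc, ← haar_mul_podles]
  simp only [← mul_assoc, mul_add, add_mul, map_add]
  simp only [mul_assoc]
  ring

/-- Integration by parts: the two identities used are `h((x₀ (x₁ ◁ E) x₂) ◁ F) = 0` and
`h((x₀ (x₁ ◁ F) x₂) ◁ E) = 0`. -/
theorem twistedCyclicity_tau (x : Fin 3 → podles q) :
    twistedCyclicity (sigma q) (tau q (haar q)) x = tau q (haar q) x := by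
  have h0 := q.toC_ne_zero
  have hc : (Fin.cons (sigma q (x (Fin.last 2))) fun i : Fin 2 => x i.castSucc :
      Fin 3 → podles q) = ![sigma q (x 2), x 0, x 1] := by
    ext i; fin_cases i <;> rfl
  rw [twistedCyclicity, hc]
  conv_rhs => rw [vec_three x]
  generalize x 0 = x₀
  generalize x 1 = x₁
  generalize x 2 = x₂
  have hE1 : pairing (E q) (1 : OSU q) = 0 := by rw [pairing_E]; exact Fun.skew_one 0 1
  have hF1 : pairing (F q) (1 : OSU q) = 0 := by rw [pairing_F]; exact Fun.skew_one 1 0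
  have h1 := haar_rightAct (F q) (x₀ * (rightAct (E q) (x₁ : OSU q) * x₂))
  have h2 := haar_rightAct (E q) (x₀ * (rightAct (F q) (x₁ : OSU q) * x₂))
  simp only [rightAct_F_mul, rightAct_E_mul, rightAct_K_mul, rightAct_K_podles,
    rightAct_Kinv_podles, rightAct_K_E_podles, rightAct_K_F_podles, rightAct_Kinv_E_podles,
    rightAct_Kinv_F_podles, rightAct_F_E_podles, hE1, hF1, zero_mul, smul_mul_assoc,
    mul_smul_comm, map_add, map_smul, smul_eq_mul, mul_add] at h1 h2
  have e : q.toC * q.toC⁻¹ = 1 := mul_inv_cancel₀ h0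
  refine (congrArg ((-1) ^ 2 * ·) (tau_apply (haar q) (sigma q x₂) x₀ x₁)).trans ?_
  refine Eq.trans ?_ (tau_apply (haar q) x₀ x₁ x₂).symm
  simp only [← haar_mul_podles, mul_assoc]
  linear_combination q.toC * (h1 - h2) -
    (haar q (rightAct (F q) (x₀ : OSU q) * (rightAct (E q) (x₁ : OSU q) * x₂)) -
      haar q (x₀ * (rightAct (F q) (x₁ : OSU q) * rightAct (E q) (x₂ : OSU q)))) * e

/-! ### Pairing with a twisted idempotent -/

/-- A twisted coboundary of a cyclic form pairs trivially with an idempotent matrix `p` on which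
the twist acts by conjugation with the diagonal matrix `ρ`: by idempotency the three terms of the
coboundary give the same number `S = ∑ ρᵢ ψ(pᵢⱼ, pⱼᵢ)`, and `S = -S` by cyclicity. -/
theorem sum_eq_zero_of_eq_twistedCoboundary {X ι : Type*} [Ring X] [Algebra ℂ X] [Fintype ι]
    (σ : X ≃ₐ[ℂ] X) {φ : MultilinearMap ℂ (fun _ : Fin 3 => X) ℂ}
    {ψ : MultilinearMap ℂ (fun _ : Fin 2 => X) ℂ} (hφ : ∀ x, φ x = twistedCoboundary σ ψ x)
    (hψ : ∀ x, twistedCyclicity σ ψ x = ψ x) (p : ι → ι → X) (ρ : ι → ℂ)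
    (hp : ∀ i k, ∑ j, p i j * p j k = p i k) (hσ : ∀ i k, ρ i • σ (p k i) = ρ k • p k i) :
    ∑ i, ∑ j, ∑ k, ρ i * φ ![p i j, p j k, p k i] = 0 := by
  have hu0 : ∀ a b c : X, Function.update ![a, b] 0 c = ![c, b] := by
    intro a b c; ext i; fin_cases i <;> rfl
  have hu1 : ∀ a b c : X, Function.update ![a, b] 1 c = ![a, c] := by
    intro a b c; ext i; fin_cases i <;> rfl
  let β : X →ₗ[ℂ] X →ₗ[ℂ] ℂ := LinearMap.mk₂ ℂ (fun x y => ψ ![x, y])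
    (fun x y z => by simpa only [hu0] using ψ.map_update_add ![x, z] 0 x y)
    (fun c x z => by simpa only [hu0] using ψ.map_update_smul ![x, z] 0 c x)
    (fun x y z => by simpa only [hu1] using ψ.map_update_add ![x, y] 1 y z)
    (fun c x z => by simpa only [hu1] using ψ.map_update_smul ![x, z] 1 c z)
  have hβ : ∀ x y, ψ ![x, y] = β x y := fun x y => rfl
  have hcyc : ∀ x y, β x y = -β (σ y) x := by
    intro x y
    rw [← hβ, ← hβ, ← hψ ![x, y], twistedCyclicity]
    have h : (Fin.cons (σ (![x, y] (Fin.last 1))) fun i : Fin 1 => ![x, y] i.castSucc :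
        Fin 2 → X) = ![σ y, x] := by
      ext i; fin_cases i <;> rfl
    rw [h, pow_one, neg_one_mul]
  set S := ∑ i, ∑ j, ρ i * β (p i j) (p j i) with hS
  have h1 : ∑ i, ∑ j, ∑ k, ρ i * β (p i j * p j k) (p k i) = S := by
    refine Finset.sum_congr rfl fun i _ => ?_
    rw [Finset.sum_comm]
    refine Finset.sum_congr rfl fun k _ => ?_
    rw [← Finset.mul_sum, ← LinearMap.sum_apply, ← map_sum, hp]
  have h2 : ∑ i, ∑ j, ∑ k, ρ i * β (p i j) (p j k * p k i) = S := by
    refine Finset.sum_congr rfl fun i _ => Finset.sum_congr rfl fun j _ => ?_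
    rw [← Finset.mul_sum, ← map_sum, hp]
  have h3 : ∑ i, ∑ j, ∑ k, ρ i * β (σ (p k i) * p i j) (p j k) = S := by
    have : ∀ i j k, ρ i * β (σ (p k i) * p i j) (p j k) =
        ρ k * β (p k i * p i j) (p j k) := by
      intro i j k
      simpa using congrArg (fun w => β (w * p i j) (p j k)) (hσ i k)
    simp only [this]
    rw [← h1]
    exact (Finset.sum_congr rfl fun i _ => Finset.sum_comm).trans Finset.sum_comm
  have h4 : S = -S := by
    calc S = ∑ i, ∑ j, -(ρ j * β (p j i) (p i j)) := by
          refine Finset.sum_congr rfl fun i _ => Finset.sum_congr rfl fun j _ => ?_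
          rw [hcyc, mul_neg]
          simpa using congrArg (fun w => β w (p i j)) (hσ i j)
      _ = -S := by
          simp only [Finset.sum_neg_distrib]
          rw [Finset.sum_comm]
  simp only [hφ, twistedCoboundary_one, hβ, mul_add, mul_sub, Finset.sum_add_distrib,
    Finset.sum_sub_distrib]
  rw [h1, h2, h3]
  linear_combination (1 / 2 : ℂ) * h4

/-! ### The Bott idempotent -/

/-- The column `v = (a, b)`. -/
noncomputable def bottCol (q : Param) : Fin 2 → OSU q := ![gen q .a, gen q .b]

/-- The row `w = (d, -q⁻¹ c)`, which satisfies `w v = 1`. -/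
noncomputable def bottRow (q : Param) : Fin 2 → OSU q := ![gen q .d, -q.toC⁻¹ • gen q .c]

theorem bottRow_mul_bottCol : ∑ j, bottRow q j * bottCol q j = 1 := by
  simp [bottRow, bottCol, Fin.sum_univ_two, da, cb]

theorem bott_mem (i j : Fin 2) : bottCol q i * bottRow q j ∈ podles q := by
  have h0 := q.toC_ne_zero
  have hA : genA q ∈ podles q := Algebra.subset_adjoin (by simp)
  have hB : genB q ∈ podles q := Algebra.subset_adjoin (by simp)
  have hB' : genBstar q ∈ podles q := Algebra.subset_adjoin (by simp)
  fin_cases i <;> fin_cases j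
  · have h : gen q .a * gen q .d = 1 - q.toC ^ 2 • genA q := by
      rw [ad, genA, smul_smul, sub_eq_add_neg, ← neg_smul]
      congr 2
      field_simp
    change gen q .a * gen q .d ∈ podles q
    rw [h]
    exact sub_mem (one_mem _) (Subalgebra.smul_mem _ hA _)
  · change gen q .a * (-q.toC⁻¹ • gen q .c) ∈ podles q
    rw [mul_smul_comm]
    exact Subalgebra.smul_mem _ hB _
  · have h : gen q .b * gen q .d = -q.toC • genBstar q := by
      rw [genBstar, db, smul_neg, neg_smul, neg_neg, smul_inv_smul₀ h0]
    change gen q .b * gen q .d ∈ podles q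
    rw [h]
    exact Subalgebra.smul_mem _ hB' _
  · change gen q .b * (-q.toC⁻¹ • gen q .c) ∈ podles q
    rw [mul_smul_comm]
    exact hA

/-- The idempotent `pᵢⱼ = vᵢ wⱼ` over the Podleś sphere. -/
noncomputable def bott (q : Param) (i j : Fin 2) : podles q :=
  ⟨bottCol q i * bottRow q j, bott_mem i j⟩

theorem bott_mul_bott (i k : Fin 2) : ∑ j, bott q i j * bott q j k = bott q i k := by
  apply Subtype.ext
  have h : ∀ j, ((bott q i j * bott q j k : podles q) : OSU q) =
      bottCol q i * (bottRow q j * bottCol q j) * bottRow q k := by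
    intro j
    change bottCol q i * bottRow q j * (bottCol q j * bottRow q k) = _
    simp only [mul_assoc]
  rw [AddSubmonoidClass.coe_finsetSum]
  simp only [h]
  rw [← Finset.sum_mul, ← Finset.mul_sum, bottRow_mul_bottCol, mul_one]
  rfl

/-- The diagonal entries of the matrix that implements `σ` on `bott`. -/
noncomputable def bottWeight (q : Param) : Fin 2 → ℂ := ![q.toC ^ 2, 1]

theorem bottWeight_smul_sigma (i k : Fin 2) :
    bottWeight q i • sigma q (bott q k i) = bottWeight q k • bott q k i := by
  have h0 := q.toC_ne_zero
  have h1 : q.toC ^ 2 * (q.toC⁻¹ * q.toC⁻¹) = 1 := by field_simp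
  have h2 : q.toC ^ 2 * q.toC⁻¹ = q.toC := by field_simp
  apply Subtype.ext
  change bottWeight q i • (sigma q (bott q k i) : OSU q) =
    bottWeight q k • (bottCol q k * bottRow q i)
  rw [sigma_coe]
  change bottWeight q i • Uq.charAct q q.toC⁻¹ (inv_ne_zero h0) (bottCol q k * bottRow q i) = _
  fin_cases i <;> fin_cases k <;>
    simp [bottWeight, bottCol, bottRow, Uq.charAct_gen, smul_smul, h0, h1, h2]

theorem rightAct_E_bott (i j : Fin 2) : rightAct (E q) (bott q i j : OSU q) =
    q.root • (bottCol q i * rightAct (E q) (bottRow q j)) := by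
  have h1 : rightAct (E q) (bottCol q i) = 0 := by
    fin_cases i
    exacts [rightAct_E_gen .a, rightAct_E_gen .b]
  have h2 : rightAct (Kinv q) (bottCol q i) = q.root • bottCol q i := by
    fin_cases i
    exacts [rightAct_Kinv_gen .a, rightAct_Kinv_gen .b]
  change rightAct (E q) (bottCol q i * bottRow q j) = _
  rw [rightAct_E_mul, h1, h2, zero_mul, zero_add, smul_mul_assoc]

theorem rightAct_F_bott (i j : Fin 2) : rightAct (F q) (bott q i j : OSU q) =
    q.root • (rightAct (F q) (bottCol q i) * bottRow q j) := by
  have h1 : rightAct (F q) (bottRow q j) = 0 := by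
    fin_cases j
    · exact rightAct_F_gen .d
    · change rightAct (F q) (-q.toC⁻¹ • gen q .c) = 0
      rw [map_smul, rightAct_F_gen, smul_zero]
  have h2 : rightAct (K q) (bottRow q j) = q.root • bottRow q j := by
    fin_cases j
    · exact rightAct_K_gen .d
    · change rightAct (K q) (-q.toC⁻¹ • gen q .c) = q.root • (-q.toC⁻¹ • gen q .c)
      rw [map_smul, rightAct_K_gen, smul_comm]
  change rightAct (F q) (bottCol q i * bottRow q j) = _
  rw [rightAct_F_mul, h1, h2, mul_zero, add_zero, mul_smul_comm]

theorem bottRow_mul_rightAct_F_bottCol :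
    ∑ j, bottRow q j * rightAct (F q) (bottCol q j) = 0 := by
  simp [bottRow, bottCol, Fin.sum_univ_two, rightAct_F_gen, dc]

theorem rightAct_E_bottRow_mul_rightAct_F_bottCol :
    ∑ j, rightAct (E q) (bottRow q j) * rightAct (F q) (bottCol q j) = -q.toC⁻¹ • 1 := by
  have h0 := q.toC_ne_zero
  simp [bottRow, bottCol, Fin.sum_univ_two, rightAct_F_gen, rightAct_E_gen, ad, smul_smul, h0]

/-- The pairing of `τ` with `bott`, before the weighted sum over `i`. In `τ(pᵢⱼ, pⱼₖ, pₖᵢ)` the first summand of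
`τ` contains `∑ wⱼ (vⱼ ◁ F) = 0`, and the second one reduces to `q² h(vᵢ wᵢ)`. -/
theorem sum_tau_bott (i : Fin 2) :
    ∑ j, ∑ k, tau q (haar q) ![bott q i j, bott q j k, bott q k i] =
      q.toC ^ 2 * haar q (bottCol q i * bottRow q i) := by
  have h1 : ∑ j, ∑ k, (bott q i j : OSU q) * (rightAct (F q) (bott q j k : OSU q) *
      rightAct (E q) (bott q k i : OSU q)) = 0 := by
    have h : ∀ j k, (bott q i j : OSU q) * (rightAct (F q) (bott q j k : OSU q) *
        rightAct (E q) (bott q k i : OSU q)) =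
        q.toC • (bottCol q i * (bottRow q j * rightAct (F q) (bottCol q j)) *
          (bottRow q k * bottCol q k * rightAct (E q) (bottRow q i))) := by
      intro j k
      rw [rightAct_F_bott, rightAct_E_bott, q.toC_eq]
      change bottCol q i * bottRow q j * _ = _
      simp only [smul_mul_assoc, mul_smul_comm, smul_smul, mul_assoc]
    simp only [h, ← Finset.smul_sum, ← Finset.mul_sum]
    rw [← Finset.sum_mul, ← Finset.mul_sum, bottRow_mul_rightAct_F_bottCol, mul_zero, zero_mul,
      smul_zero]
  have h2 : ∑ j, ∑ k, (bott q i j : OSU q) * (rightAct (E q) (bott q j k : OSU q) *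
      rightAct (F q) (bott q k i : OSU q)) = -(bottCol q i * bottRow q i) := by
    have h : ∀ j k, (bott q i j : OSU q) * (rightAct (E q) (bott q j k : OSU q) *
        rightAct (F q) (bott q k i : OSU q)) =
        q.toC • (bottCol q i * (bottRow q j * bottCol q j) *
          (rightAct (E q) (bottRow q k) * rightAct (F q) (bottCol q k) * bottRow q i)) := by
      intro j k
      rw [rightAct_F_bott, rightAct_E_bott, q.toC_eq]
      change bottCol q i * bottRow q j * _ = _
      simp only [smul_mul_assoc, mul_smul_comm, smul_smul, mul_assoc]
    simp only [h, ← Finset.smul_sum, ← Finset.mul_sum]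
    rw [← Finset.sum_mul, ← Finset.mul_sum, bottRow_mul_bottCol, ← Finset.sum_mul,
      rightAct_E_bottRow_mul_rightAct_F_bottCol, mul_one, smul_mul_assoc, one_mul, mul_smul_comm,
      smul_smul, mul_neg, mul_inv_cancel₀ q.toC_ne_zero, neg_one_smul]
  simp only [tau_apply, Finset.sum_sub_distrib, ← Finset.mul_sum, ← map_sum]
  simp only [← Finset.mul_sum] at h1 h2
  rw [h1, h2, map_zero, map_neg]
  ring

/-- The weights turn `∑ vᵢ wᵢ` into `∑ wᵢ vᵢ = 1` under the Haar state, as `q² h(ad) = h(da)`. -/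
theorem sum_bottWeight_mul_tau_bott :
    ∑ i, ∑ j, ∑ k, bottWeight q i * tau q (haar q) ![bott q i j, bott q j k, bott q k i] =
      q.toC ^ 2 := by
  have h0 := q.toC_ne_zero
  simp only [← Finset.mul_sum, sum_tau_bott]
  rw [Fin.sum_univ_two]
  change q.toC ^ 2 * (q.toC ^ 2 * haar q (gen q .a * gen q .d)) +
    1 * (q.toC ^ 2 * haar q (gen q .b * (-q.toC⁻¹ • gen q .c))) = _
  have h : haar q (gen q .d * gen q .a) = 1 + q.toC⁻¹ * haar q (gen q .b * gen q .c) := by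
    rw [da, map_add, haar_one, map_smul, smul_eq_mul]
  rw [haar_mul_d, h, mul_smul_comm, map_smul, smul_eq_mul]
  field_simp
  ring

theorem isNontrivial_tau (q : Param) : IsNontrivial (sigma q) (tau q (haar q)) := by
  rintro ⟨ψ, hψ, hcyc⟩
  have h := sum_eq_zero_of_eq_twistedCoboundary (sigma q) hψ hcyc (bott q) (bottWeight q)
    bott_mul_bott bottWeight_smul_sigma
  rw [sum_bottWeight_mul_tau_bott] at h
  exact pow_ne_zero 2 q.toC_ne_zero h

end QSphere

theorem lemma4p5 (q : QSphere.Param) :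
    ∃ h : QSphere.OSU q →ₗ[ℂ] ℂ,
      QSphere.IsHaarState h ∧
      (∀ h' : QSphere.OSU q →ₗ[ℂ] ℂ, QSphere.IsHaarState h' → h' = h) ∧
      QSphere.IsTwistedCyclicCocycle (QSphere.sigma q) (QSphere.tau q h) ∧
      QSphere.IsNontrivial (QSphere.sigma q) (QSphere.tau q h) :=
  ⟨QSphere.haar q, QSphere.isHaarState_haar q, fun _ h => h.eq_haar,
    ⟨QSphere.twistedCoboundary_tau, QSphere.twistedCyclicity_tau⟩, QSphere.isNontrivial_tau q⟩
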